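/- Write $e[t]=\exp(2\pi\sqrt{-1}\,t)$, let $\mathbb T=\mathbb R/\mathbb Z$, and let $\delta>0$. A sequence $(\omega_1,\omega_2,\ldots)$ in $[0,1]$ is called $(\delta,1)$-quasi-random if there is a constant $C>0$ such that for all integers $N\ge 1$ $$\left|\frac1{N^5}\sum_{i_1,i_2=1}^{N}\ \sum_{\substack{1\le j_1,j_2,j_3,j_4\le N\\ j_1+j_3=j_2+j_4}} e\!\left[\frac{\omega_{i_1}-\omega_{i_2}}{2}\,(j_1^2-j_2^2+j_3^2-j_4^2)\right]\right|\le C N^{-\delta}.$$ For $x=(x_1,\ldots,x_N)\in\mathbb T^N$ and $y=(y_1,\ldots,y_N)\in\mathbb T^N$, let $X$ be the $N\times N$ matrix with entries $$X_{i,j}=N^{-1/2}\,e\big[(T_{\omega_i}^{\,j}(x_i,y_i))_1\big]=N^{-1/2}\,e\!\left[\tbinom j2\omega_i+jy_i+x_i\right],\qquad 1\le i,j\le N,$$ where $T_\omega(x,y)=(x+y,\,y+\omega)$ is the skew-shift on $\mathbb T^2$, let $H_{N,N}=\begin{pmatrix}0&X\\X^*&0\end{pmatrix}$, and let $\mu^{(2k)}_{N,N}=\frac1{2N}\operatorname{Tr}\big[H_{N,N}^{2k}\big]$.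 Let $\mathbb E_{\underline y}$ denote the average over $y\in[0,1]^N$ with respect to Lebesgue measure. **Theorem.** Let $\delta>0$, let $(\omega_1,\omega_2,\ldots)$ be $(\delta,1)$-quasi-random, and let $k\ge1$. Then, as $N\to\infty$, $$\mathbb E_{\underline y}\big[\mu^{(2k)}_{N,N}\big]=c_k+O(N^{-\delta/16}),\qquad c_k=\frac1{k+1}\binom{2k}{k},$$ uniformly in $(x_1,x_2,\ldots)$; that is, there is a constant $C'>0$, independent of $N$ and of $(x_i)$, such that $\big|\mathbb E_{\underline y}[\mu^{(2k)}_{N,N}]-c_k\big|\le C'N^{-\delta/16}$ for all $N\ge1$. -/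

import Mathlib

open scoped Matrix

noncomputable section

namespace SkewShift

/-- The character `e[t] = exp (2 π i t)` of the torus `𝕋 = ℝ / ℤ`. -/
def e (t : UnitAddCircle) : ℂ := (AddCircle.toCircle t : ℂ)

theorem e_coe (t : ℝ) : e (t : UnitAddCircle) = Complex.exp (2 * Real.pi * Complex.I * t) := by
  rw [e, AddCircle.toCircle_apply_mk, Circle.coe_exp]
  congr 1
  push_cast
  ring

/-- The skew-shift with frequency `ω` on the two-dimensional torus. -/
def skewShift (ω : UnitAddCircle) (p : UnitAddCircle × UnitAddCircle) :
    UnitAddCircle × UnitAddCircle :=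
  (p.1 + p.2, p.2 + ω)

theorem skewShift_iterate_fst (ω x y : UnitAddCircle) (j : ℕ) :
    ((skewShift ω)^[j] (x, y)).1 = j.choose 2 • ω + j • y + x := by
  have h : (skewShift ω)^[j] (x, y) = (j.choose 2 • ω + j • y + x, y + j • ω) := by
    induction j with
    | zero => simp
    | succ n ih =>
      rw [Function.iterate_succ_apply', ih]
      simp only [skewShift, Prod.mk.injEq]
      rw [Nat.choose_succ_succ' n 1, Nat.choose_one_right]
      constructor <;> module
  rw [h]

/-- The `M × N` matrix `X` with entries `N ^ (-1/2) * e[(T_{ω_i}^j (x_i, y_i))_1]`. The column with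
index `j : Fin N` is the `(j + 1)`-st column. -/
def X (M N : ℕ) (ω x y : Fin M → UnitAddCircle) : Matrix (Fin M) (Fin N) ℂ :=
  Matrix.of fun i j =>
    (((Real.sqrt N)⁻¹ : ℝ) : ℂ) * e ((skewShift (ω i))^[(j : ℕ) + 1] (x i, y i)).1

/-- The Hermitian block matrix with off-diagonal blocks `X` and `X*`. -/
def H (M N : ℕ) (ω x y : Fin M → UnitAddCircle) : Matrix (Fin M ⊕ Fin N) (Fin M ⊕ Fin N) ℂ :=
  Matrix.fromBlocks 0 (X M N ω x y) (X M N ω x y)ᴴ 0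

/-- The normalized moment `(2 N)⁻¹ Tr (H ^ (2 k))`. -/
def moment (M N k : ℕ) (ω x y : Fin M → UnitAddCircle) : ℂ :=
  (1 / (2 * (N : ℂ))) * (H M N ω x y ^ (2 * k)).trace

/-- The average over the cube `[0, 1] ^ M` with respect to Lebesgue measure. -/
def average {M : ℕ} (f : (Fin M → ℝ) → ℂ) : ℂ :=
  ∫ y in Set.Icc (0 : Fin M → ℝ) 1, f y

/-- `(δ, ρ)`-quasi-random sequences of frequencies in `[0, 1]`. The sequence
`(ω_1, ω_2, …)` is indexed by `ℕ`, so that `ω i` is its `(i + 1)`-st term. -/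
def IsQuasiRandom (δ ρ : ℝ) (ω : ℕ → ℝ) : Prop :=
  (∀ i, ω i ∈ Set.Icc (0 : ℝ) 1) ∧
  ∃ C : ℝ, 0 < C ∧ ∀ N : ℕ, 1 ≤ N →
    ‖(1 / (N : ℂ) ^ 5) *
      ∑ i₁ ∈ Finset.range ⌊ρ * N⌋₊, ∑ i₂ ∈ Finset.range ⌊ρ * N⌋₊,
        ∑ j₁ ∈ Finset.Icc 1 N, ∑ j₂ ∈ Finset.Icc 1 N,
          ∑ j₃ ∈ Finset.Icc 1 N, ∑ j₄ ∈ Finset.Icc 1 N,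
            if j₁ + j₃ = j₂ + j₄ then
              e (((ω i₁ - ω i₂) / 2 *
                ((j₁ : ℝ) ^ 2 - (j₂ : ℝ) ^ 2 + (j₃ : ℝ) ^ 2 - (j₄ : ℝ) ^ 2) : ℝ) : UnitAddCircle)
            else 0‖ ≤ C * (N : ℝ) ^ (-δ)

end SkewShift

end

/-! Write k = n + 1. The trace of `(X Xᴴ) ^ (n + 1)` expands over closed walks q of length n + 1 on
the row indices and over edge weights J with values in [1, N], namely the column indices. The
x-phases cancel around a closed walk. Averaging over y keeps exactly the J that satisfy Kirchhoff's
law at every vertex (`flux q J = 0`), with phase ∑ ω_v / 2 · flux(J²)(v) and prefactor N^-(n+2)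
(`average_moment`). Walks are grouped by the partition s of the positions into visits to the same
vertex. Labelling the r blocks arbitrarily instead of injectively costs a relative error O(1/N), and
the sum over labels then factors over the blocks (`labelledSum_eq`). By Euler's formula the
circulations have rank n + 2 - r. If s is noncrossing, Kirchhoff's law forces the weights around
each block to be equal in pairs, so J² is a circulation whenever J is
(`Noncrossing.flux_sq_eq_zero`). All phases vanish and there are exactly N^(n+2-r) circulations, so
the partition contributes 1 in the limit. Noncrossing partitions are counted by the Catalan numbers
(`card_noncrossing_setoid`). If s has a crossing a < b < c < d, then J can be moved by u around the
loop from a to c and by v around the loop from b to d. The loops overlap, and flux(J²) at the vertex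
of a acquires the term -2uv (`flux_sq_add_arcs`). After Cauchy–Schwarz in the label of that vertex,
the phase involves (ω_i - ω_i') / 2 and is bilinear in (u, v) up to affine terms. Further
applications of Cauchy–Schwarz bound the sum by the additive energies that quasi-randomness controls
(`norm_sum_bilinear_pow_le`). The saving is N^(-δ/8), so crossing partitions are negligible. -/

namespace SkewShift

/-! ### Characters and geometric sums. -/

/-- The character `t ↦ exp (2 π i t)` on the real line. -/
noncomputable def ee (t : ℝ) : ℂ := e (t : UnitAddCircle)

theorem e_zero : e 0 = 1 := by simp [e]

theorem e_add (s t : UnitAddCircle) : e (s + t) = e s * e t := by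
  simp [e, AddCircle.toCircle_add]

theorem e_neg (t : UnitAddCircle) : e (-t) = (starRingEnd ℂ) (e t) := by
  rw [e, e, AddCircle.toCircle_neg, Circle.coe_inv_eq_conj]

theorem e_sum {ι : Type*} (s : Finset ι) (f : ι → UnitAddCircle) :
    e (∑ i ∈ s, f i) = ∏ i ∈ s, e (f i) := by
  classical
  induction s using Finset.induction_on with
  | empty => simp [e_zero]
  | insert a s ha ih => rw [Finset.sum_insert ha, Finset.prod_insert ha, e_add, ih]

theorem ee_zero : ee 0 = 1 := by simp [ee, e_zero]

theorem ee_add (s t : ℝ) : ee (s + t) = ee s * ee t := by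
  rw [ee, AddCircle.coe_add, e_add]; rfl

theorem ee_neg (t : ℝ) : ee (-t) = (starRingEnd ℂ) (ee t) := by
  rw [ee, AddCircle.coe_neg, e_neg]; rfl

theorem ee_sub (s t : ℝ) : ee (s - t) = ee s * (starRingEnd ℂ) (ee t) := by
  rw [sub_eq_add_neg, ee_add, ee_neg]

theorem ee_sum {ι : Type*} (s : Finset ι) (f : ι → ℝ) :
    ee (∑ i ∈ s, f i) = ∏ i ∈ s, ee (f i) := by
  classical
  induction s using Finset.induction_on with
  | empty => simp [ee_zero]
  | insert a s ha ih => rw [Finset.sum_insert ha, Finset.prod_insert ha, ee_add, ih]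

@[simp] theorem norm_ee (t : ℝ) : ‖ee t‖ = 1 := Circle.norm_coe _

/-- The Dirichlet-type geometric sum `∑_{j < n} e[j t]`. -/
noncomputable def dirichletSum (n : ℕ) (t : ℝ) : ℂ := ∑ j ∈ Finset.range n, ee (j * t)

theorem dirichletSum_add (m n : ℕ) (t : ℝ) :
    dirichletSum (m + n) t = dirichletSum m t + ee (m * t) * dirichletSum n t := by
  rw [dirichletSum, Finset.sum_range_add, dirichletSum, dirichletSum, Finset.mul_sum]
  congr 1
  refine Finset.sum_congr rfl fun j _ => ?_
  rw [← ee_add]; push_cast; ring_nf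

theorem norm_sq_dirichletSum_le (m n : ℕ) (t : ℝ) :
    ‖dirichletSum n t‖ ^ 2 ≤ 2 * ‖dirichletSum m t‖ ^ 2 + 2 * ‖dirichletSum (m + n) t‖ ^ 2 := by
  have h : ‖dirichletSum n t‖ ≤ ‖dirichletSum m t‖ + ‖dirichletSum (m + n) t‖ := by
    have h1 : ee (m * t) * dirichletSum n t = dirichletSum (m + n) t - dirichletSum m t := by
      rw [dirichletSum_add]; ring
    calc ‖dirichletSum n t‖ = ‖ee (m * t) * dirichletSum n t‖ := by simp
      _ ≤ _ := by rw [h1, add_comm ‖dirichletSum m t‖]; exact norm_sub_le _ _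
  nlinarith [norm_nonneg (dirichletSum n t),
    sq_nonneg (‖dirichletSum m t‖ - ‖dirichletSum (m + n) t‖)]

/-- Up to a phase, a sum of length n is the difference of the sums of lengths m and m + n. Averaging
over m in a window of N values trades the uncontrolled length n for all lengths in a fixed window of
size 2N, which also contains the shift by n ≤ N. -/
theorem norm_sq_dirichletSum_le_average {n N : ℕ} (hn : n ≤ N) (M : ℕ) (t : ℝ) :
    N * ‖dirichletSum n t‖ ^ 2 ≤ 4 * ∑ m ∈ Finset.range (2 * N), ‖dirichletSum (M + m) t‖ ^ 2 := by
  have h1 : ∑ m ∈ Finset.range N, ‖dirichletSum (M + m) t‖ ^ 2 ≤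
      ∑ m ∈ Finset.range (2 * N), ‖dirichletSum (M + m) t‖ ^ 2 :=
    Finset.sum_le_sum_of_subset_of_nonneg (Finset.range_mono (by omega))
      fun _ _ _ => by positivity
  have h2 : ∑ m ∈ Finset.range N, ‖dirichletSum (M + m + n) t‖ ^ 2 ≤
      ∑ m ∈ Finset.range (2 * N), ‖dirichletSum (M + m) t‖ ^ 2 := by
    rw [show ∑ m ∈ Finset.range N, ‖dirichletSum (M + m + n) t‖ ^ 2 =
      ∑ m ∈ (Finset.range N).map (addRightEmbedding n), ‖dirichletSum (M + m) t‖ ^ 2 by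
        simp [Finset.sum_map, add_assoc]]
    refine Finset.sum_le_sum_of_subset_of_nonneg ?_ fun _ _ _ => by positivity
    intro x hx
    simp only [Finset.mem_map, Finset.mem_range, addRightEmbedding_apply] at hx ⊢
    omega
  have h3 : N * ‖dirichletSum n t‖ ^ 2 ≤ ∑ m ∈ Finset.range N,
      (2 * ‖dirichletSum (M + m) t‖ ^ 2 + 2 * ‖dirichletSum (M + m + n) t‖ ^ 2) := by
    have := Finset.sum_le_sum fun m (_ : m ∈ Finset.range N) =>
      norm_sq_dirichletSum_le (M + m) n t
    simpa using this
  rw [Finset.sum_add_distrib, ← Finset.mul_sum, ← Finset.mul_sum] at h3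
  linarith

theorem norm_sum_Ico_ee (a : ℤ) (n : ℕ) (t : ℝ) :
    ‖∑ u ∈ Finset.Ico a (a + n), ee (u * t)‖ = ‖dirichletSum n t‖ := by
  have : ∑ u ∈ Finset.Ico a (a + n), ee (u * t) = ee (a * t) * dirichletSum n t := by
    rw [dirichletSum, Finset.mul_sum]
    symm
    refine Finset.sum_bij (fun j _ => a + (j : ℤ)) ?_ ?_ ?_ ?_
    · intro j hj; simp at hj ⊢; omega
    · intro i _ j _ h; simpa using h
    · intro u hu
      simp only [Finset.mem_Ico] at hu
      exact ⟨(u - a).toNat, by simp; omega, by omega⟩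
    · intro j _
      rw [← ee_add]; push_cast; ring_nf
  rw [this, norm_mul, norm_ee, one_mul]

theorem norm_sum_ordConnected_ee (I : Finset ℤ) (hI : (I : Set ℤ).OrdConnected) (t : ℝ) :
    ‖∑ u ∈ I, ee (u * t)‖ = ‖dirichletSum I.card t‖ := by
  rcases I.eq_empty_or_nonempty with rfl | hne
  · simp [dirichletSum]
  have h : I = Finset.Ico (I.min' hne) (I.min' hne + ((I.max' hne + 1 - I.min' hne).toNat : ℕ)) := by
    have hle : I.min' hne ≤ I.max' hne := Finset.min'_le _ _ (Finset.max'_mem _ _)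
    ext u
    simp only [Finset.mem_Ico]
    constructor
    · intro hu
      have := Finset.min'_le _ _ hu
      have := Finset.le_max' _ _ hu
      omega
    · intro hu
      exact hI.out (Finset.min'_mem _ hne) (Finset.max'_mem _ hne) ⟨by omega, by omega⟩
  have hc : I.card = (I.max' hne + 1 - I.min' hne).toNat := by
    conv_lhs => rw [h]
    rw [Int.card_Ico, add_sub_cancel_left, Int.toNat_natCast]
  rw [hc, ← norm_sum_Ico_ee (I.min' hne), ← h]

/-! ### Additive energy and quasi-randomness. -/

/-- The additive energy `∑_{j₁ + j₃ = j₂ + j₄} e[θ (j₁² - j₂² + j₃² - j₄²)]` of a quadratic phase,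
written as a sum of squares. -/
noncomputable def energy (N : ℕ) (θ : ℝ) : ℝ :=
  ∑ a ∈ Finset.Ioo (-(N : ℤ)) N, ‖dirichletSum (N - a.natAbs) (2 * θ * a)‖ ^ 2

theorem energy_nonneg (N : ℕ) (θ : ℝ) : 0 ≤ energy N θ :=
  Finset.sum_nonneg fun _ _ => by positivity

/-- On pairs of difference a, the phase (y + a)² - y² = a² + 2ay is linear in y, which runs over an
interval of N - |a| integers. -/
theorem norm_sum_pairs_eq (N : ℕ) (θ : ℝ) (a : ℤ) (ha : a ∈ Finset.Ioo (-(N : ℤ)) N) :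
    ‖∑ q ∈ (Finset.Icc 1 N ×ˢ Finset.Icc 1 N) with ((q.1 : ℤ) - q.2 = a),
      ee (θ * ((q.1 : ℝ) ^ 2 - (q.2 : ℝ) ^ 2))‖ = ‖dirichletSum (N - a.natAbs) (2 * θ * a)‖ := by
  simp only [Finset.mem_Ioo] at ha
  have h : ∑ q ∈ (Finset.Icc 1 N ×ˢ Finset.Icc 1 N) with ((q.1 : ℤ) - q.2 = a),
      ee (θ * ((q.1 : ℝ) ^ 2 - (q.2 : ℝ) ^ 2)) =
      ee (θ * a ^ 2) * ∑ u ∈ Finset.Ico (max 1 (1 - a)) (max 1 (1 - a) + (N - a.natAbs : ℕ)),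
        ee (u * (2 * θ * a)) := by
    rw [Finset.mul_sum]
    refine Finset.sum_bij (fun q _ => (q.2 : ℤ)) ?_ ?_ ?_ ?_
    · rintro ⟨x, y⟩ hq
      simp at hq ⊢
      omega
    · rintro ⟨x, y⟩ hq ⟨x', y'⟩ hq' h
      simp at hq hq' h ⊢
      omega
    · intro u hu
      simp only [Finset.mem_Ico] at hu
      exact ⟨((u + a).toNat, u.toNat), by simp; omega, by simp; omega⟩
    · rintro ⟨x, y⟩ hq
      simp only [Finset.mem_filter, Finset.mem_product, Finset.mem_Icc] at hq
      have hx : (x : ℝ) = y + a := by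
        have : (x : ℤ) = y + a := by omega
        exact_mod_cast this
      rw [← ee_add]
      simp only [hx]
      push_cast
      ring_nf
  rw [h, norm_mul, norm_ee, one_mul, norm_sum_Ico_ee]

/-- Group by a = j₁ - j₂ = j₄ - j₃: the sum over (j₃, j₄) is the complex conjugate of the sum over
(j₁, j₂). -/
theorem sum_quadruples_eq_energy (N : ℕ) (θ : ℝ) :
    ∑ j₁ ∈ Finset.Icc 1 N, ∑ j₂ ∈ Finset.Icc 1 N, ∑ j₃ ∈ Finset.Icc 1 N, ∑ j₄ ∈ Finset.Icc 1 N,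
      (if j₁ + j₃ = j₂ + j₄ then
        ee (θ * ((j₁ : ℝ) ^ 2 - (j₂ : ℝ) ^ 2 + (j₃ : ℝ) ^ 2 - (j₄ : ℝ) ^ 2)) else 0) =
      (energy N θ : ℂ) := by
  have key : ∀ a ∈ Finset.Ioo (-(N : ℤ)) N,
      ((‖dirichletSum (N - a.natAbs) (2 * θ * a)‖ ^ 2 : ℝ) : ℂ) =
      ∑ q ∈ (Finset.Icc 1 N ×ˢ Finset.Icc 1 N) with ((q.1 : ℤ) - q.2 = a),
        ∑ r ∈ (Finset.Icc 1 N ×ˢ Finset.Icc 1 N), if (r.2 : ℤ) - r.1 = (q.1 : ℤ) - q.2 then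
          ee (θ * ((q.1 : ℝ) ^ 2 - (q.2 : ℝ) ^ 2 + (r.1 : ℝ) ^ 2 - (r.2 : ℝ) ^ 2)) else 0 := by
    intro a ha
    rw [← norm_sum_pairs_eq N θ a ha, Complex.ofReal_pow, ← Complex.mul_conj', map_sum,
      Finset.sum_mul_sum]
    refine Finset.sum_congr rfl fun q hq => ?_
    rw [Finset.sum_filter, Finset.sum_product, Finset.sum_product_right]
    refine Finset.sum_congr rfl fun x _ => Finset.sum_congr rfl fun y _ => ?_
    rw [(Finset.mem_filter.1 hq).2]
    split_ifs with h
    · rw [← ee_sub]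
      ring_nf
    · rfl
  rw [energy, Complex.ofReal_sum, Finset.sum_congr rfl key,
    Finset.sum_fiberwise_of_maps_to, Finset.sum_product]
  · refine Finset.sum_congr rfl fun j₁ _ => Finset.sum_congr rfl fun j₂ _ => ?_
    rw [Finset.sum_product]
    refine Finset.sum_congr rfl fun j₃ _ => Finset.sum_congr rfl fun j₄ _ => ?_
    simp only
    congr 1
    exact propext ⟨fun h => by omega, fun h => by omega⟩
  · rintro ⟨x, y⟩ hq
    simp at hq ⊢
    omega

theorem sq_le_energy_zero (N : ℕ) (hN : 1 ≤ N) : (N : ℝ) ^ 2 ≤ energy N 0 := by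
  have h : (0 : ℤ) ∈ Finset.Ioo (-(N : ℤ)) N := by simp; omega
  have := Finset.single_le_sum (f := fun a : ℤ => ‖dirichletSum (N - a.natAbs) (2 * 0 * a)‖ ^ 2)
    (fun _ _ => by positivity) h
  refine le_trans ?_ this
  simp [dirichletSum, ee_zero]

theorem IsQuasiRandom.sum_energy_le {δ : ℝ} {ω : ℕ → ℝ} (hω : IsQuasiRandom δ 1 ω) :
    ∃ C : ℝ, 0 < C ∧ ∀ N : ℕ, 1 ≤ N →
      ∑ i₁ ∈ Finset.range N, ∑ i₂ ∈ Finset.range N, energy N ((ω i₁ - ω i₂) / 2) ≤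
        C * (N : ℝ) ^ 5 * (N : ℝ) ^ (-δ) := by
  obtain ⟨-, C, hC, h⟩ := hω
  refine ⟨C, hC, fun N hN => ?_⟩
  have hN' : (0 : ℝ) < N := by exact_mod_cast hN
  have h1 := h N hN
  have h2 : ∀ i₁ i₂ : ℕ, ∑ j₁ ∈ Finset.Icc 1 N, ∑ j₂ ∈ Finset.Icc 1 N,
      ∑ j₃ ∈ Finset.Icc 1 N, ∑ j₄ ∈ Finset.Icc 1 N,
      (if j₁ + j₃ = j₂ + j₄ then
        e (((ω i₁ - ω i₂) / 2 *
          ((j₁ : ℝ) ^ 2 - (j₂ : ℝ) ^ 2 + (j₃ : ℝ) ^ 2 - (j₄ : ℝ) ^ 2) : ℝ) : UnitAddCircle)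
      else 0) = (energy N ((ω i₁ - ω i₂) / 2) : ℂ) :=
    fun i₁ i₂ => sum_quadruples_eq_energy N ((ω i₁ - ω i₂) / 2)
  simp only [one_mul, Nat.floor_natCast, h2] at h1
  have h3 : (1 / (N : ℂ) ^ 5) * ∑ i₁ ∈ Finset.range N, ∑ i₂ ∈ Finset.range N,
      (energy N ((ω i₁ - ω i₂) / 2) : ℂ) =
      (((1 / (N : ℝ) ^ 5) * ∑ i₁ ∈ Finset.range N, ∑ i₂ ∈ Finset.range N,
        energy N ((ω i₁ - ω i₂) / 2) : ℝ) : ℂ) := by push_cast; rfl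
  rw [h3, Complex.norm_real, Real.norm_of_nonneg] at h1
  · rw [one_div, inv_mul_le_iff₀ (by positivity)] at h1
    linarith
  · have := fun i₁ i₂ => energy_nonneg N ((ω i₁ - ω i₂) / 2)
    have := Finset.sum_nonneg fun i₁ (_ : i₁ ∈ Finset.range N) =>
      Finset.sum_nonneg fun i₂ (_ : i₂ ∈ Finset.range N) => this i₁ i₂
    positivity

/-- The diagonal i₁ = i₂ alone contributes at least N · N² to a sum bounded by C N^(5-δ). This crude
bound serves to absorb errors of relative size 1/N into N^(-δ/16). -/
theorem IsQuasiRandom.le_two {δ : ℝ} {ω : ℕ → ℝ} (hω : IsQuasiRandom δ 1 ω) : δ ≤ 2 := by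
  obtain ⟨C, hC, h⟩ := hω.sum_energy_le
  by_contra! hδ
  have h1 : ∀ N : ℕ, 1 ≤ N → (N : ℝ) ^ (δ - 2) ≤ C := by
    intro N hN
    have hN' : (0 : ℝ) < N := by exact_mod_cast hN
    have h2 : (N : ℝ) * N ^ 2 ≤ C * (N : ℝ) ^ 5 * (N : ℝ) ^ (-δ) := by
      refine le_trans ?_ (h N hN)
      calc (N : ℝ) * N ^ 2 = ∑ i₁ ∈ Finset.range N, (N : ℝ) ^ 2 := by simp
        _ ≤ _ := by
          refine Finset.sum_le_sum fun i hi => ?_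
          refine le_trans ?_ (Finset.single_le_sum
            (f := fun i₂ => energy N ((ω i - ω i₂) / 2)) (fun _ _ => energy_nonneg _ _) hi)
          simpa using sq_le_energy_zero N hN
    rw [Real.rpow_sub hN', div_le_iff₀ (by positivity)]
    rw [Real.rpow_neg hN'.le] at h2
    have h3 : (0 : ℝ) < (N : ℝ) ^ δ := by positivity
    rw [← div_eq_mul_inv, le_div_iff₀ h3] at h2
    have h4 : (N : ℝ) ^ 3 * (N : ℝ) ^ δ ≤ (N : ℝ) ^ 3 * (C * (N : ℝ) ^ 2) := by nlinarith
    have h5 := le_of_mul_le_mul_left h4 (by positivity)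
    exact_mod_cast h5
  have h2 : Filter.Tendsto (fun N : ℕ => (N : ℝ) ^ (δ - 2)) Filter.atTop Filter.atTop :=
    (tendsto_rpow_atTop (by linarith)).comp tendsto_natCast_atTop_atTop
  obtain ⟨N, hN1, hN2⟩ := ((h2.eventually_gt_atTop C).and (Filter.eventually_ge_atTop 1)).exists
  exact absurd (h1 N hN2) (not_le.2 hN1)

/-- The energies at the scales between `N` and `3 N` control all geometric sums of length at most
`N`. -/
noncomputable def totalEnergy (N : ℕ) (θ : ℝ) : ℝ := ∑ m ∈ Finset.range (2 * N), energy (N + m) θ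

theorem totalEnergy_nonneg (N : ℕ) (θ : ℝ) : 0 ≤ totalEnergy N θ :=
  Finset.sum_nonneg fun _ _ => energy_nonneg _ _

/-- Energies contain only the lengths N - |a|, whereas Cauchy–Schwarz over a general region produces
arbitrary lengths. Averaging over windows starting at N - |a| turns the latter into the terms of the
energies at scales N + m. -/
theorem sum_norm_sq_dirichletSum_le_totalEnergy (N : ℕ) (θ : ℝ) (c : ℤ → ℕ) (hc : ∀ a, c a ≤ N) :
    N * ∑ a ∈ Finset.Ioo (-(N : ℤ)) N, ‖dirichletSum (c a) (2 * θ * a)‖ ^ 2 ≤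
      4 * totalEnergy N θ := by
  have h1 : ∀ a ∈ Finset.Ioo (-(N : ℤ)) N, N * ‖dirichletSum (c a) (2 * θ * a)‖ ^ 2 ≤
      4 * ∑ m ∈ Finset.range (2 * N), ‖dirichletSum (N + m - a.natAbs) (2 * θ * a)‖ ^ 2 := by
    intro a ha
    refine (norm_sq_dirichletSum_le_average (hc a) (N - a.natAbs) _).trans_eq ?_
    congr 1
    refine Finset.sum_congr rfl fun m _ => ?_
    simp only [Finset.mem_Ioo] at ha
    rw [show N - a.natAbs + m = N + m - a.natAbs by omega]
  rw [Finset.mul_sum]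
  refine (Finset.sum_le_sum h1).trans ?_
  rw [← Finset.mul_sum, Finset.sum_comm]
  refine mul_le_mul_of_nonneg_left (Finset.sum_le_sum fun m _ => ?_) (by norm_num)
  refine Finset.sum_le_sum_of_subset_of_nonneg ?_ fun _ _ _ => by positivity
  intro a ha
  simp only [Finset.mem_Ioo] at ha ⊢
  push_cast
  omega

theorem IsQuasiRandom.sum_totalEnergy_le {δ : ℝ} (hδ : 0 < δ) {ω : ℕ → ℝ}
    (hω : IsQuasiRandom δ 1 ω) :
    ∃ C : ℝ, 0 < C ∧ ∀ N : ℕ, 1 ≤ N →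
      ∑ i₁ ∈ Finset.range N, ∑ i₂ ∈ Finset.range N, totalEnergy N ((ω i₁ - ω i₂) / 2) ≤
        C * (N : ℝ) ^ 6 * (N : ℝ) ^ (-δ) := by
  obtain ⟨C, hC, h⟩ := hω.sum_energy_le
  refine ⟨2 * C * 3 ^ 5, by positivity, fun N hN => ?_⟩
  have hN' : (0 : ℝ) < N := by exact_mod_cast hN
  have h1 : ∑ i₁ ∈ Finset.range N, ∑ i₂ ∈ Finset.range N, totalEnergy N ((ω i₁ - ω i₂) / 2) =
      ∑ m ∈ Finset.range (2 * N), ∑ i₁ ∈ Finset.range N, ∑ i₂ ∈ Finset.range N,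
        energy (N + m) ((ω i₁ - ω i₂) / 2) := by
    simp only [totalEnergy]
    symm
    rw [Finset.sum_comm]
    refine Finset.sum_congr rfl fun i₁ _ => ?_
    rw [Finset.sum_comm]
  rw [h1]
  have h2 : ∀ m ∈ Finset.range (2 * N), ∑ i₁ ∈ Finset.range N, ∑ i₂ ∈ Finset.range N,
        energy (N + m) ((ω i₁ - ω i₂) / 2) ≤ C * (3 * N : ℝ) ^ 5 * (N : ℝ) ^ (-δ) := by
    intro m hm
    -- Energies are nonnegative, so the frequencies may be extended up to the scale N + m < 3N
    -- before quasi-randomness is applied at that scale.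
    have hs : Finset.range N ⊆ Finset.range (N + m) := Finset.range_mono (by omega)
    calc _ ≤ ∑ i₁ ∈ Finset.range (N + m), ∑ i₂ ∈ Finset.range (N + m),
          energy (N + m) ((ω i₁ - ω i₂) / 2) := by
          refine (Finset.sum_le_sum fun i₁ _ => Finset.sum_le_sum_of_subset_of_nonneg hs
            fun _ _ _ => energy_nonneg _ _).trans ?_
          exact Finset.sum_le_sum_of_subset_of_nonneg hs
            fun _ _ _ => Finset.sum_nonneg fun _ _ => energy_nonneg _ _
      _ ≤ C * ((N + m : ℕ) : ℝ) ^ 5 * ((N + m : ℕ) : ℝ) ^ (-δ) := h _ (by omega)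
      _ ≤ _ := by
        have hm' : ((N + m : ℕ) : ℝ) ≤ 3 * N := by
          have := Finset.mem_range.1 hm
          exact_mod_cast (by omega : N + m ≤ 3 * N)
        have hm'' : (N : ℝ) ≤ ((N + m : ℕ) : ℝ) := by exact_mod_cast Nat.le_add_right N m
        have := Real.rpow_le_rpow_of_nonpos hN' hm'' (by linarith : -δ ≤ 0)
        have := pow_le_pow_left₀ (by positivity) hm' 5
        refine mul_le_mul (mul_le_mul_of_nonneg_left this hC.le) ?_ ?_ ?_ <;>
          first | assumption | positivity
  refine (Finset.sum_le_sum h2).trans_eq ?_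
  simp
  ring

end SkewShift

/-! ### Circulations on a closed walk. -/

namespace SkewShift

open Classical in
/-- The divergence at each vertex of a weight `J` on the edges of the closed walk `p`: the edge `l`
leads from `p l` to `p (l + 1)`. -/
noncomputable def flux {n : ℕ} {P R : Type*} [CommRing R] (p : Fin (n + 1) → P) :
    (Fin (n + 1) → R) →ₗ[R] (P → R) where
  toFun J v := ∑ l, if p l = v then J l - J (l - 1) else 0
  map_add' J J' := by
    ext v
    simp only [Pi.add_apply, ← Finset.sum_add_distrib]
    refine Finset.sum_congr rfl fun l _ => ?_
    split_ifs <;> ring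
  map_smul' c J := by
    ext v
    simp only [Pi.smul_apply, smul_eq_mul, RingHom.id_apply, Finset.mul_sum]
    refine Finset.sum_congr rfl fun l _ => ?_
    split_ifs <;> ring

open Classical in
theorem flux_apply {n : ℕ} {P R : Type*} [CommRing R] (p : Fin (n + 1) → P)
    (J : Fin (n + 1) → R) (v : P) :
    flux p J v = ∑ l, if p l = v then J l - J (l - 1) else 0 := rfl

theorem flux_comp_apply {n : ℕ} {P Q R : Type*} [CommRing R] (p : Fin (n + 1) → P)
    (f : P → Q) (hf : Function.Injective f) (J : Fin (n + 1) → R) (v : P) :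
    flux (f ∘ p) J (f v) = flux p J v := by
  rw [flux_apply, flux_apply]
  refine Finset.sum_congr rfl fun l _ => ?_
  by_cases h : p l = v
  · simp [h]
  · rw [Function.comp_apply, if_neg h, if_neg fun h' : f (p l) = f v => h (hf h')]

theorem flux_eq_zero_of_notMem_range {n : ℕ} {P R : Type*} [CommRing R] (p : Fin (n + 1) → P)
    (J : Fin (n + 1) → R) (v : P) (hv : ∀ l, p l ≠ v) : flux p J v = 0 := by
  simp [flux_apply, hv]

theorem sum_flux_mul {n : ℕ} {P R : Type*} [CommRing R] [Fintype P] (p : Fin (n + 1) → P)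
    (J : Fin (n + 1) → R) (w : P → R) :
    ∑ v, w v * flux p J v = ∑ l, w (p l) * (J l - J (l - 1)) := by
  classical
  simp only [flux_apply, Finset.mul_sum]
  rw [Finset.sum_comm]
  refine Finset.sum_congr rfl fun l _ => ?_
  simp

theorem sum_sub_pred_eq_zero {n : ℕ} {R : Type*} [AddCommGroup R] (J : Fin (n + 1) → R) :
    ∑ l, (J l - J (l - 1)) = 0 := by
  rw [Finset.sum_sub_distrib, sub_eq_zero]
  exact (Equiv.sum_comp (Equiv.subRight (1 : Fin (n + 1))) J).symm

theorem sum_flux {n : ℕ} {P R : Type*} [CommRing R] [Fintype P] (p : Fin (n + 1) → P)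
    (J : Fin (n + 1) → R) : ∑ v, flux p J v = 0 := by
  have := sum_flux_mul p J 1
  simpa only [Pi.one_apply, one_mul, sum_sub_pred_eq_zero] using this

theorem flux_map {n : ℕ} {P R S : Type*} [CommRing R] [CommRing S] (f : R →+* S)
    (p : Fin (n + 1) → P) (J : Fin (n + 1) → R) (v : P) :
    flux p (fun l => f (J l)) v = f (flux p J v) := by
  simp only [flux_apply, map_sum, apply_ite f, map_sub, map_zero]

theorem coe_sub_one {n : ℕ} {l : Fin (n + 1)} (h : l ≠ 0) : ((l - 1 : Fin (n + 1)) : ℕ) = l - 1 :=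
  Fin.val_sub_one_of_ne_zero h

/-- The indicator of the edges from position `x` to position `y`. -/
def arc {n : ℕ} (x y : Fin (n + 1)) (l : Fin (n + 1)) : ℤ := if x ≤ l ∧ l < y then 1 else 0

theorem arc_sub_pred {n : ℕ} {x y : Fin (n + 1)} (h : x ≤ y) (l : Fin (n + 1)) :
    arc x y l - arc x y (l - 1) = (if l = x then 1 else 0) - (if l = y then 1 else 0) := by
  rcases eq_or_ne l 0 with rfl | hl
  · have h1 : ((0 - 1 : Fin (n + 1)) : ℕ) = n := by simp
    have h2 : ¬ (0 - 1 < y) := by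
      rw [Fin.lt_def, h1]; omega
    simp only [arc, h2, and_false, if_false, Fin.ext_iff, Fin.le_def, Fin.lt_def, Fin.val_zero] at *
    split_ifs <;> omega
  · have h1 := coe_sub_one hl
    have h2 : (l : ℕ) ≠ 0 := fun h => hl (Fin.ext h)
    simp only [arc, Fin.ext_iff, Fin.le_def, Fin.lt_def, h1] at *
    split_ifs <;> omega

open Classical in
theorem flux_arc {n : ℕ} {P : Type*} (p : Fin (n + 1) → P) {x y : Fin (n + 1)} (h : x ≤ y) (v : P) :
    flux p (arc x y) v = (if p x = v then 1 else 0) - (if p y = v then 1 else 0) := by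
  simp only [flux_apply, arc_sub_pred h]
  rw [show (∑ l, if p l = v then ((if l = x then (1 : ℤ) else 0) - if l = y then 1 else 0) else 0) =
    ∑ l, ((if l = x then (if p l = v then 1 else 0) else 0) -
      (if l = y then (if p l = v then 1 else 0) else 0)) from
    Finset.sum_congr rfl fun l _ => by split_ifs <;> simp]
  simp

open Classical in
/-- The integral circulations on the closed walk `p` with values in `[a, b]`. -/
noncomputable def cycleBox {n : ℕ} {P : Type*} (p : Fin (n + 1) → P) (a b : ℤ) :
    Finset (Fin (n + 1) → ℤ) :=
  (Fintype.piFinset fun _ => Finset.Icc a b).filter fun J => flux p J = 0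

theorem mem_cycleBox {n : ℕ} {P : Type*} {p : Fin (n + 1) → P} {a b : ℤ} {J : Fin (n + 1) → ℤ} :
    J ∈ cycleBox p a b ↔ (∀ l, a ≤ J l ∧ J l ≤ b) ∧ flux p J = 0 := by
  simp [cycleBox, Fintype.mem_piFinset]

/-- The edges by which the vertices other than `p 0` are first reached form a spanning tree, and a
circulation is determined by its values on the remaining n + 1 - (|P| - 1) edges. -/
theorem card_cycleBox_le {n : ℕ} {P : Type*} [Fintype P] (p : Fin (n + 1) → P)
    (hp : Function.Surjective p) (a b : ℤ) :
    (cycleBox p a b).card ≤ (b + 1 - a).toNat ^ (n + 2 - Fintype.card P) := by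
  classical
  have h : ∀ v : P, ∃ l, p l = v ∧ ∀ l', p l' = v → l ≤ l' := by
    intro v
    obtain ⟨l₀, hl₀⟩ := hp v
    obtain ⟨l, hl, hmin⟩ := Finset.exists_min_image (Finset.univ.filter fun l => p l = v) id
      ⟨l₀, by simpa using hl₀⟩
    exact ⟨l, by simpa using hl, fun l' h' => hmin l' (by simpa using h')⟩
  choose first hfirst hmin using h
  have hfirst0 : ∀ v, v ≠ p 0 → first v ≠ 0 := by
    intro v hv h0
    exact hv (by rw [← h0, hfirst])
  set T : Finset (Fin (n + 1)) := (Finset.univ.erase (p 0)).image fun v => first v - 1 with hT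
  have hcard : T.card = Fintype.card P - 1 := by
    rw [hT, Finset.card_image_of_injective]
    · simp
    · intro v w hvw
      have h1 : first v = first w := sub_left_injective hvw
      rw [← hfirst v, h1, hfirst]
  -- Downward induction on the position: in Kirchhoff's law at v, every edge other than the first
  -- one entering v comes later in the walk.
  have hdet : ∀ d : Fin (n + 1) → ℤ, flux p d = 0 → (∀ l, l ∉ T → d l = 0) → ∀ l, d l = 0 := by
    intro d hd hoff l
    induction l using WellFoundedGT.induction with
    | ind l ih =>
      by_cases hl : l ∈ T
      swap
      · exact hoff l hl
      obtain ⟨v, hv, rfl⟩ := Finset.mem_image.1 hl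
      have hv0 := hfirst0 v (Finset.ne_of_mem_erase hv)
      have hval := coe_sub_one hv0
      have hpos : (first v : ℕ) ≠ 0 := fun h => hv0 (Fin.ext h)
      have h1 := congrFun hd v
      rw [flux_apply, Finset.sum_eq_single (first v)] at h1
      · rw [if_pos (hfirst v), ih (first v) (by rw [Fin.lt_def]; omega)] at h1
        simpa using h1
      · intro l' _ hl'
        split_ifs with hpl
        · have h2 := hmin v l' hpl
          rw [Fin.le_def] at h2
          have h2' : (first v : ℕ) ≠ l' := fun h => hl' (Fin.ext h.symm)
          have h3 : l' ≠ 0 := fun h => by rw [h] at h2 h2'; simp at h2 h2'; omega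
          have h4 := coe_sub_one h3
          rw [ih l' (by rw [Fin.lt_def]; omega),
            ih (l' - 1) (by rw [Fin.lt_def]; omega), sub_zero]
        · rfl
      · simp
  have hinj : Set.InjOn (fun (J : Fin (n + 1) → ℤ) (l : {l // l ∈ Tᶜ}) => J l)
      (cycleBox p a b) := by
    intro J hJ J' hJ' hJJ
    have := hdet (J - J') (by
      rw [map_sub, (mem_cycleBox.1 hJ).2, (mem_cycleBox.1 hJ').2, sub_zero]) (by
      intro l hl
      have := congrFun hJJ ⟨l, by simpa using hl⟩
      simp only at this
      simp [this])
    ext l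
    have := this l
    simp only [Pi.sub_apply] at this
    omega
  have hle := Finset.card_le_card_of_injOn _ (t := Fintype.piFinset fun _ : {l // l ∈ Tᶜ} => Finset.Icc a b)
    (fun J hJ => by
      rw [Fintype.coe_piFinset]
      intro l _
      simpa using (mem_cycleBox.1 hJ).1 l) hinj
  refine hle.trans_eq ?_
  have hP : 1 ≤ Fintype.card P := Fintype.card_pos_iff.2 ⟨p 0⟩
  have hPn : Fintype.card P ≤ n + 1 := by simpa using Fintype.card_le_of_surjective p hp
  rw [Fintype.card_piFinset, Finset.prod_const, Finset.card_univ, Int.card_Icc, Fintype.card_coe, Finset.card_compl, hcard,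
    Fintype.card_fin]
  congr 1
  omega

/-! ### Circulations on noncrossing walks. -/

/-- The closed walk `p` is noncrossing if its level sets form a noncrossing partition. -/
def Noncrossing {n : ℕ} {P : Type*} (p : Fin n → P) : Prop :=
  ∀ a b c d, a < b → b < c → c < d → p a = p c → p b = p d → p a = p b

theorem sum_Icc_sub_pred {n : ℕ} {R : Type*} [AddCommGroup R] (J : Fin (n + 1) → R)
    (x y : Fin (n + 1)) (h : x ≤ y) :
    ∑ l ∈ Finset.Icc x y, (J l - J (l - 1)) = J y - J (x - 1) := by
  induction y using Fin.induction with
  | zero =>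
    obtain rfl : x = 0 := Fin.le_zero_iff.1 h
    simp
  | succ y ih =>
    rcases eq_or_lt_of_le h with rfl | hlt
    · simp
    · have hle : x ≤ y.castSucc := Fin.le_castSucc_iff.2 hlt
      have hI : Finset.Icc x y.succ = insert y.succ (Finset.Icc x y.castSucc) := by
        ext l
        simp only [Finset.mem_Icc, Finset.mem_insert, Fin.le_def, Fin.ext_iff, Fin.val_succ,
          Fin.val_castSucc] at *
        omega
      have hs : y.succ - 1 = y.castSucc := by
        rw [sub_eq_iff_eq_add, Fin.coeSucc_eq_succ]
      rw [hI, Finset.sum_insert (by simp [Fin.le_def]), ih hle, hs]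
      abel

/-- An interval of positions that is a union of blocks has total flux zero, and this total
telescopes to outgoing minus incoming weight. -/
theorem eq_pred_of_saturated {n : ℕ} {P R : Type*} [CommRing R] (p : Fin (n + 1) → P)
    (J : Fin (n + 1) → R) (hJ : flux p J = 0) (x y : Fin (n + 1)) (h : x ≤ y)
    (hsat : ∀ l l', p l = p l' → l ∈ Finset.Icc x y → l' ∈ Finset.Icc x y) :
    J (x - 1) = J y := by
  classical
  have h1 : ∑ v ∈ (Finset.Icc x y).image p, flux p J v = 0 := by simp [hJ]
  have h2 : ∑ l ∈ Finset.Icc x y, (J l - J (l - 1)) = 0 := by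
    rw [← h1]
    simp only [flux_apply]
    rw [Finset.sum_comm, ← Finset.sum_subset (Finset.subset_univ (Finset.Icc x y))]
    · refine Finset.sum_congr rfl fun l hl => ?_
      rw [Finset.sum_ite_eq, if_pos (Finset.mem_image_of_mem p hl)]
    · intro l _ hl
      rw [Finset.sum_ite_eq, if_neg]
      intro hm
      obtain ⟨l', hl', hp⟩ := Finset.mem_image.1 hm
      exact hl (hsat l' l hp hl')
  rw [sum_Icc_sub_pred J x y h, sub_eq_zero] at h2
  exact h2.symm

/-- A block with positions both inside and outside the span of the block of x would cross it, so
this span is saturated. -/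
theorem Noncrossing.eq_pred_of_block {n : ℕ} {P R : Type*} [CommRing R] {p : Fin (n + 1) → P}
    (hp : Noncrossing p) (J : Fin (n + 1) → R) (hJ : flux p J = 0) (x y : Fin (n + 1))
    (hxy : p x = p y) (hx : ∀ l, p l = p x → x ≤ l) (hy : ∀ l, p l = p x → l ≤ y) :
    J (x - 1) = J y := by
  refine eq_pred_of_saturated p J hJ x y (hx y hxy.symm) fun l l' hll hl => ?_
  simp only [Finset.mem_Icc] at hl ⊢
  by_cases hlx : p l = p x
  · exact ⟨hx l' (by rw [← hll, hlx]), hy l' (by rw [← hll, hlx])⟩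
  have h1 : x < l := lt_of_le_of_ne hl.1 fun h => hlx (by rw [h])
  have h2 : l < y := lt_of_le_of_ne hl.2 fun h => hlx (by rw [h, hxy])
  by_contra hcon
  rcases lt_or_ge l' x with h3 | h3
  · exact hlx (by rw [hll]; exact hp l' x l y h3 h1 h2 hll.symm hxy)
  · have h4 : y < l' := not_le.1 fun h => hcon ⟨h3, h⟩
    exact hlx (hp x l y l' h1 h2 h4 hxy hll).symm

/-- The positions strictly between two consecutive visits to a vertex form a saturated interval,
again by the absence of crossings. -/
theorem Noncrossing.eq_pred_of_consecutive {n : ℕ} {P R : Type*} [CommRing R]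
    {p : Fin (n + 1) → P} (hp : Noncrossing p) (J : Fin (n + 1) → R) (hJ : flux p J = 0)
    (x y : Fin (n + 1)) (hxy : p x = p y) (hlt : x < y)
    (hcons : ∀ l, x < l → l < y → p l ≠ p x) : J (y - 1) = J x := by
  have hx1 : ((x + 1 : Fin (n + 1)) : ℕ) = x + 1 := by
    rw [Fin.val_add_one, if_neg]
    intro h
    rw [h] at hlt
    exact absurd (Fin.le_last y) (not_le.2 hlt)
  have hy1 : ((y - 1 : Fin (n + 1)) : ℕ) = y - 1 := coe_sub_one (by
    rintro rfl
    exact absurd (Fin.zero_le x) (not_le.2 hlt))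
  rcases Nat.lt_or_ge (x + 1 : ℕ) y with h | h
  · have := eq_pred_of_saturated p J hJ (x + 1) (y - 1) (by rw [Fin.le_def]; omega) ?_
    · rw [← this, add_sub_cancel_right]
    intro l l' hll hl
    simp only [Finset.mem_Icc, Fin.le_def, hx1, hy1] at hl ⊢
    have h1 : x < l := by rw [Fin.lt_def]; omega
    have h2 : l < y := by rw [Fin.lt_def]; omega
    have hlx := hcons l h1 h2
    by_contra hcon
    have hne : p l' ≠ p x := fun h => hlx (hll.trans h)
    have hne1 : (l' : ℕ) ≠ x := fun h => hne (by rw [Fin.ext h])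
    have hne2 : (l' : ℕ) ≠ y := fun h => hne (by rw [Fin.ext h, hxy])
    rcases Nat.lt_or_ge (l' : ℕ) x with h3 | h3
    · exact hlx (by rw [hll]; exact hp l' x l y h3 h1 h2 hll.symm hxy)
    · exact hlx (hp x l y l' h1 h2 (by rw [Fin.lt_def]; omega) hxy hll).symm
  · congr 1
    rw [Fin.lt_def] at hlt
    exact Fin.ext (by omega)

/-- On the circulations of a noncrossing closed walk the edge leaving position `l` carries the same
weight as the edge entering the next position of the block of `l`. -/
theorem Noncrossing.exists_successor {n : ℕ} {P : Type*} {p : Fin (n + 1) → P}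
    (hp : Noncrossing p) (v : P) :
    ∃ (s : ℕ) (o : Fin s → Fin (n + 1)) (σ : Equiv.Perm (Fin s)), Function.Injective o ∧
      (∀ l, p l = v ↔ ∃ t, o t = l) ∧
      ∀ (R : Type) [CommRing R] (J : Fin (n + 1) → R), flux p J = 0 →
        ∀ t, J (o (σ t) - 1) = J (o t) := by
  classical
  set B : Finset (Fin (n + 1)) := Finset.univ.filter fun l => p l = v with hB
  have hmem : ∀ l, l ∈ B ↔ p l = v := by simp [hB]
  rcases Nat.eq_zero_or_pos B.card with h0 | hpos
  · refine ⟨0, Fin.elim0, 1, fun t => t.elim0, fun l => ?_, fun _ _ _ _ t => t.elim0⟩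
    rw [← hmem, Finset.card_eq_zero.1 h0]
    simp
  obtain ⟨s, hs⟩ : ∃ s, B.card = s + 1 := ⟨B.card - 1, by omega⟩
  set o := B.orderEmbOfFin hs with ho
  have hrange : ∀ l, p l = v ↔ ∃ t, o t = l := by
    intro l
    rw [← hmem, ← Finset.mem_coe, ← Finset.range_orderEmbOfFin B hs]
    rfl
  have hpo : ∀ t, p (o t) = v := fun t => (hrange _).2 ⟨t, rfl⟩
  -- The block is listed increasingly and the successor is the cyclic shift; the wrap from its last
  -- to its first position is the spanning-interval case.
  refine ⟨s + 1, o, Equiv.addRight 1, o.injective, hrange, fun R _ J hJ t => ?_⟩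
  simp only [Equiv.coe_addRight]
  rcases eq_or_ne t (Fin.last s) with rfl | ht
  · rw [Fin.last_add_one]
    refine hp.eq_pred_of_block J hJ _ _ (by rw [hpo, hpo]) ?_ ?_
    · intro l hl
      obtain ⟨t', rfl⟩ := (hrange l).1 (hl.trans (hpo 0))
      exact o.monotone (Fin.zero_le t')
    · intro l hl
      obtain ⟨t', rfl⟩ := (hrange l).1 (hl.trans (hpo 0))
      exact o.monotone (Fin.le_last t')
  · have ht' : t < t + 1 := Fin.lt_add_one_iff.2 (Fin.lt_last_iff_ne_last.2 ht)
    have hv : ((t + 1 : Fin (s + 1)) : ℕ) = t + 1 := by rw [Fin.val_add_one, if_neg ht]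
    refine hp.eq_pred_of_consecutive J hJ _ _ (by rw [hpo, hpo]) (o.strictMono ht') ?_
    intro l h1 h2 hl
    obtain ⟨t', rfl⟩ := (hrange l).1 (hl.trans (hpo t))
    have h3 := o.lt_iff_lt.1 h1
    have h4 := o.lt_iff_lt.1 h2
    rw [Fin.lt_def] at h3 h4
    omega

/-- At each vertex, outgoing and incoming edges are matched by equalities valid for all
circulations. Any weight respecting these equalities is therefore a circulation. This is used for
squares of circulations and for arbitrary weights constant on classes of edges. -/
theorem Noncrossing.flux_eq_zero_of_forall {n : ℕ} {P S : Type} [CommRing S] {p : Fin (n + 1) → P}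
    (hp : Noncrossing p) (G : Fin (n + 1) → S)
    (hG : ∀ l l', (∀ (R : Type) [CommRing R] (J : Fin (n + 1) → R), flux p J = 0 → J l = J l') →
      G l = G l') : flux p G = 0 := by
  classical
  ext v
  obtain ⟨s, o, σ, hinj, hrange, hJ⟩ := hp.exists_successor v
  rw [flux_apply, ← Finset.sum_filter]
  have hB : (Finset.univ.filter fun l => p l = v) = Finset.univ.map ⟨o, hinj⟩ := by
    ext l
    simp [hrange]
  rw [hB, Finset.sum_map, Finset.sum_sub_distrib, Pi.zero_apply, sub_eq_zero]
  simp only [Function.Embedding.coeFn_mk]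
  rw [← Equiv.sum_comp σ fun t => G (o t - 1)]
  refine Finset.sum_congr rfl fun t _ => ?_
  exact (hG _ _ fun R _ J h => hJ R J h t).symm

theorem Noncrossing.flux_sq_eq_zero {n : ℕ} {P : Type} {p : Fin (n + 1) → P}
    (hp : Noncrossing p) (J : Fin (n + 1) → ℤ) (hJ : flux p J = 0) : flux p (J ^ 2) = 0 := by
  refine hp.flux_eq_zero_of_forall _ fun l l' h => ?_
  rw [Pi.pow_apply, Pi.pow_apply, h ℤ J hJ]

/-- Rank–nullity: fluxes sum to zero over the vertices, so the flux map is not onto. -/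
theorem le_finrank_ker_flux {n : ℕ} {P : Type} [Fintype P] (p : Fin (n + 1) → P) :
    n + 2 - Fintype.card P ≤ Module.finrank ℚ (LinearMap.ker (flux (R := ℚ) p)) := by
  classical
  have h1 := LinearMap.finrank_range_add_finrank_ker (flux (R := ℚ) p)
  have h2 : LinearMap.range (flux (R := ℚ) p) ≠ ⊤ := by
    intro h
    obtain ⟨J, hJ⟩ := LinearMap.range_eq_top.1 h (Pi.single (p 0) 1)
    have := sum_flux p J
    rw [hJ] at this
    simp at this
  have h3 := Submodule.finrank_lt h2
  simp only [Module.finrank_fintype_fun_eq_card, Fintype.card_fin] at h1 h3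
  omega

/-- For the lower bound, identify edges on which all rational circulations agree. Circulations embed
in functions on the classes, so there are at least n + 2 - |P| classes, and every choice of a value
in [1, N] on each class is a circulation. -/
theorem Noncrossing.card_cycleBox {n : ℕ} {P : Type} [Fintype P] {p : Fin (n + 1) → P}
    (hp : Noncrossing p) (hsurj : Function.Surjective p) (N : ℕ) (hN : 1 ≤ N) :
    (cycleBox p 1 N).card = N ^ (n + 2 - Fintype.card P) := by
  classical
  refine le_antisymm (by simpa using card_cycleBox_le p hsurj 1 N) ?_
  let K := LinearMap.ker (flux (R := ℚ) p)
  let s : Setoid (Fin (n + 1)) := Setoid.ker fun l (J : K) => (J : Fin (n + 1) → ℚ) l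
  have hs : ∀ l l', s l l' ↔ ∀ J : K, (J : Fin (n + 1) → ℚ) l = (J : Fin (n + 1) → ℚ) l' :=
    fun l l' => by
      rw [Setoid.ker_def, funext_iff]
  let φ : K →ₗ[ℚ] (Quotient s → ℚ) :=
    { toFun := fun J q => (J : Fin (n + 1) → ℚ) q.out
      map_add' := fun _ _ => rfl
      map_smul' := fun _ _ => rfl }
  have hφ : Function.Injective φ := by
    intro J J' h
    ext l
    have h1 := congrFun h ⟦l⟧
    have h2 := (hs _ _).1 (Quotient.mk_out (s := s) l)
    change (J : Fin (n + 1) → ℚ) (⟦l⟧ : Quotient s).out =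
      (J' : Fin (n + 1) → ℚ) (⟦l⟧ : Quotient s).out at h1
    rw [← h2 J, ← h2 J', h1]
  have hcard : n + 2 - Fintype.card P ≤ Fintype.card (Quotient s) := by
    refine (le_finrank_ker_flux p).trans ?_
    simpa using LinearMap.finrank_le_finrank_of_injective hφ
  refine (Nat.pow_le_pow_right hN hcard).trans ?_
  have := Finset.card_le_card_of_injOn
    (s := Fintype.piFinset fun _ : Quotient s => Finset.Icc (1 : ℤ) N) (t := cycleBox p 1 N)
    (fun g l => g ⟦l⟧) ?_ ?_
  · simpa using this
  · intro g hg
    rw [Finset.mem_coe, Fintype.mem_piFinset] at hg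
    refine mem_cycleBox.2 ⟨fun l => Finset.mem_Icc.1 (hg _), ?_⟩
    refine hp.flux_eq_zero_of_forall _ fun l l' h => ?_
    have : (⟦l⟧ : Quotient s) = ⟦l'⟧ := Quotient.sound ((hs l l').2 fun J => h ℚ J J.2)
    simp only [this]
  · intro g _ g' _ h
    ext q
    obtain ⟨l, rfl⟩ := Quotient.exists_rep q
    exact congrFun h l

end SkewShift

/-! ### Exponential sums over circulations of a crossing walk. -/

namespace SkewShift

/-- A bilinear exponential sum over a region with interval slices, bounded by the energies of the
quadratic phase. -/
theorem norm_sum_bilinear_pow_le (N : ℕ) (hN : 1 ≤ N) (θ c L M : ℝ) (Ω : Finset (ℤ × ℤ))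
    (hΩ : Ω ⊆ Finset.Icc 1 (N : ℤ) ×ˢ Finset.Icc 1 (N : ℤ))
    (hconn : ∀ v, {u | (u, v) ∈ Ω}.OrdConnected) :
    ‖∑ z ∈ Ω, ee (θ * (c + z.1 * L + z.2 * M - 2 * z.1 * z.2))‖ ^ 4 ≤
      4 * (N : ℝ) ^ 4 * totalEnergy N θ := by
  classical
  have hN' : (0 : ℝ) < N := by exact_mod_cast hN
  set B := Finset.Icc (1 : ℤ) N with hB
  have hBcard : (B.card : ℝ) = N := by simp [hB]
  let T : ℤ → ℂ := fun u => ∑ v ∈ B with (u, v) ∈ Ω, ee (θ * (v * M - 2 * u * v))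
  let G : ℤ → ℤ → ℝ := fun v v' =>
    ‖dirichletSum (B.filter fun u => (u, v) ∈ Ω ∧ (u, v') ∈ Ω).card (2 * θ * ((v' - v : ℤ) : ℝ))‖
  have h1 : ‖∑ z ∈ Ω, ee (θ * (c + z.1 * L + z.2 * M - 2 * z.1 * z.2))‖ ≤ ∑ u ∈ B, ‖T u‖ := by
    have : ∑ z ∈ Ω, ee (θ * (c + z.1 * L + z.2 * M - 2 * z.1 * z.2)) =
        ∑ u ∈ B, ee (θ * (c + u * L)) * T u := by
      have hΩ' : Ω = (B ×ˢ B).filter (· ∈ Ω) := by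
        ext z
        simp only [Finset.mem_filter]
        exact ⟨fun h => ⟨hΩ h, h⟩, fun h => h.2⟩
      conv_lhs => rw [hΩ']
      rw [Finset.sum_filter, Finset.sum_product]
      refine Finset.sum_congr rfl fun u _ => ?_
      rw [← Finset.sum_filter, Finset.mul_sum]
      refine Finset.sum_congr rfl fun v _ => ?_
      rw [← ee_add]
      ring_nf
    rw [this]
    refine (norm_sum_le _ _).trans_eq (Finset.sum_congr rfl fun u _ => ?_)
    rw [norm_mul, norm_ee, one_mul]
  -- Expand the square and sum over u first: u runs over the intersection of two slices, an
  -- interval, with frequency 2θ(v' - v).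
  have h2 : ∑ u ∈ B, ‖T u‖ ^ 2 ≤ ∑ v ∈ B, ∑ v' ∈ B, G v v' := by
    have h3 : ((∑ u ∈ B, ‖T u‖ ^ 2 : ℝ) : ℂ) = ∑ v ∈ B, ∑ v' ∈ B, ee (θ * ((v - v') * M)) *
        ∑ u ∈ B with ((u, v) ∈ Ω ∧ (u, v') ∈ Ω), ee (u * (2 * θ * ((v' - v : ℤ) : ℝ))) := by
      have h4 : ∀ u ∈ B, ((‖T u‖ ^ 2 : ℝ) : ℂ) = ∑ v ∈ B, ∑ v' ∈ B,
          if (u, v) ∈ Ω ∧ (u, v') ∈ Ω then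
            ee (θ * ((v - v') * M)) * ee (u * (2 * θ * ((v' - v : ℤ) : ℝ))) else 0 := by
        intro u _
        rw [Complex.ofReal_pow, ← Complex.mul_conj', map_sum, Finset.sum_mul_sum,
          Finset.sum_filter]
        refine Finset.sum_congr rfl fun v _ => ?_
        rw [Finset.sum_filter]
        by_cases hv : (u, v) ∈ Ω
        · simp only [hv, if_true, true_and]
          refine Finset.sum_congr rfl fun v' _ => ?_
          split_ifs
          · rw [← ee_sub, ← ee_add]
            push_cast
            ring_nf
          · rfl
        · simp [hv]
      rw [Complex.ofReal_sum, Finset.sum_congr rfl h4, Finset.sum_comm]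
      refine Finset.sum_congr rfl fun v _ => ?_
      rw [Finset.sum_comm]
      refine Finset.sum_congr rfl fun v' _ => ?_
      rw [Finset.mul_sum, Finset.sum_filter]
    have h5 : ∑ u ∈ B, ‖T u‖ ^ 2 = ‖((∑ u ∈ B, ‖T u‖ ^ 2 : ℝ) : ℂ)‖ := by
      rw [Complex.norm_real, Real.norm_of_nonneg (Finset.sum_nonneg fun _ _ => by positivity)]
    rw [h5, h3]
    refine (norm_sum_le _ _).trans (Finset.sum_le_sum fun v _ => ?_)
    refine (norm_sum_le _ _).trans_eq (Finset.sum_congr rfl fun v' _ => ?_)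
    rw [norm_mul, norm_ee, one_mul, norm_sum_ordConnected_ee]
    have : ((B.filter fun u => (u, v) ∈ Ω ∧ (u, v') ∈ Ω : Finset ℤ) : Set ℤ) =
        {u | (u, v) ∈ Ω} ∩ {u | (u, v') ∈ Ω} := by
      ext u
      simp only [Finset.coe_filter, Set.mem_ofPred_eq, Set.mem_inter_iff]
      exact ⟨fun h => h.2, fun h => ⟨(Finset.mem_product.1 (hΩ h.1)).1, h⟩⟩
    rw [this]
    exact (hconn v).inter (hconn v')
  have h6 : ∑ v ∈ B, ∑ v' ∈ B, G v v' ^ 2 ≤ 4 * totalEnergy N θ := by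
    have h7 : ∀ v ∈ B, N * ∑ v' ∈ B, G v v' ^ 2 ≤ 4 * totalEnergy N θ := by
      intro v hv
      refine le_trans ?_ (sum_norm_sq_dirichletSum_le_totalEnergy N θ
        (fun a => (B.filter fun u => (u, v) ∈ Ω ∧ (u, v + a) ∈ Ω).card) fun a =>
          (Finset.card_filter_le _ _).trans (by simp [hB]))
      refine mul_le_mul_of_nonneg_left ?_ hN'.le
      have h8 : ∑ v' ∈ B, G v v' ^ 2 = ∑ a ∈ B.image (· - v),
          ‖dirichletSum (B.filter fun u => (u, v) ∈ Ω ∧ (u, v + a) ∈ Ω).card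
            (2 * θ * a)‖ ^ 2 := by
        rw [Finset.sum_image fun x _ y _ h => by simpa using h]
        simp [G]
      rw [h8]
      refine Finset.sum_le_sum_of_subset_of_nonneg ?_ fun _ _ _ => by positivity
      intro a ha
      simp only [hB, Finset.mem_image, Finset.mem_Icc, Finset.mem_Ioo] at ha hv ⊢
      omega
    have h9 := Finset.sum_le_sum h7
    rw [← Finset.mul_sum, Finset.sum_const, nsmul_eq_mul, hBcard] at h9
    exact le_of_mul_le_mul_left h9 hN'
  have h10 : (∑ v ∈ B, ∑ v' ∈ B, G v v') ^ 2 ≤ (N : ℝ) ^ 2 * (4 * totalEnergy N θ) := by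
    rw [← Finset.sum_product']
    refine sq_sum_le_card_mul_sum_sq.trans ?_
    rw [Finset.card_product, Finset.sum_product, Nat.cast_mul, hBcard, ← sq]
    exact mul_le_mul_of_nonneg_left h6 (by positivity)
  have h11 : (∑ u ∈ B, ‖T u‖) ^ 2 ≤ N * ∑ v ∈ B, ∑ v' ∈ B, G v v' := by
    refine sq_sum_le_card_mul_sum_sq.trans ?_
    rw [hBcard]
    exact mul_le_mul_of_nonneg_left h2 hN'.le
  calc _ ≤ (∑ u ∈ B, ‖T u‖) ^ 4 := pow_le_pow_left₀ (norm_nonneg _) h1 4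
    _ = ((∑ u ∈ B, ‖T u‖) ^ 2) ^ 2 := by ring
    _ ≤ (N * ∑ v ∈ B, ∑ v' ∈ B, G v v') ^ 2 := pow_le_pow_left₀ (by positivity) h11 2
    _ = (N : ℝ) ^ 2 * (∑ v ∈ B, ∑ v' ∈ B, G v v') ^ 2 := by ring
    _ ≤ (N : ℝ) ^ 2 * ((N : ℝ) ^ 2 * (4 * totalEnergy N θ)) :=
      mul_le_mul_of_nonneg_left h10 (by positivity)
    _ = _ := by ring

/-- The two arcs are closed loops, so the u² and v² terms have no flux. Their overlap is the arc
from b to c, which is not closed: it ends at the vertex of a, where it has flux -1. -/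
theorem flux_sq_add_arcs {n : ℕ} {P : Type*} (p : Fin (n + 1) → P) {a b c d : Fin (n + 1)}
    (hab : a < b) (hbc : b < c) (hcd : c < d) (hac : p a = p c) (hbd : p b = p d)
    (hne : p a ≠ p b) (ρ : Fin (n + 1) → ℤ) (u v : ℤ) :
    flux p ((ρ + u • arc a c + v • arc b d) ^ 2) (p a) =
      flux p (ρ ^ 2) (p a) + u * (2 * flux p (ρ * arc a c) (p a)) +
        v * (2 * flux p (ρ * arc b d) (p a)) - 2 * u * v := by
  have h : (ρ + u • arc a c + v • arc b d) ^ 2 = ρ ^ 2 + (2 * u) • (ρ * arc a c) +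
      (2 * v) • (ρ * arc b d) + (u ^ 2) • arc a c + (v ^ 2) • arc b d +
        (2 * u * v) • arc b c := by
    ext l
    have h1 : arc a c l * arc b d l = arc b c l := by
      simp only [arc]
      split_ifs <;> omega
    have h2 : arc a c l * arc a c l = arc a c l := by simp [arc]
    have h3 : arc b d l * arc b d l = arc b d l := by simp [arc]
    simp only [Pi.add_apply, Pi.pow_apply, Pi.smul_apply, Pi.mul_apply, smul_eq_mul]
    linear_combination u ^ 2 * h2 + v ^ 2 * h3 + 2 * u * v * h1
  rw [h]
  simp only [map_add, map_smul, Pi.add_apply, Pi.smul_apply, smul_eq_mul,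
    flux_arc p (hab.trans hbc).le, flux_arc p (hbc.trans hcd).le, flux_arc p hbc.le]
  rw [← hbd, ← hac]
  simp only [if_true, if_neg hne.symm]
  ring

theorem flux_arc_eq_zero {n : ℕ} {P : Type*} (p : Fin (n + 1) → P) {x y : Fin (n + 1)} (h : x ≤ y)
    (hxy : p x = p y) : flux p (arc x y) = 0 := by
  ext v
  rw [flux_arc p h, hxy, sub_self]
  rfl

/-- Fibre the circulations over their part ρ transverse to the two crossing loops. Each fibre gives
a bilinear sum, and the number of fibres is smaller than the full count by a factor of order N². -/
theorem norm_sum_cycleBox_pow_le {n : ℕ} {P : Type*} [Fintype P] (p : Fin (n + 1) → P)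
    (hp : Function.Surjective p) {a b c d : Fin (n + 1)}
    (hab : a < b) (hbc : b < c) (hcd : c < d) (hac : p a = p c) (hbd : p b = p d)
    (hne : p a ≠ p b) (N : ℕ) (hN : 1 ≤ N) (θ : ℝ) :
    (N : ℝ) ^ 4 * ‖∑ J ∈ cycleBox p 1 N, ee (θ * (flux p (J ^ 2) (p a) : ℤ))‖ ^ 4 ≤
      4 * (5 * N : ℝ) ^ (4 * (n + 2 - Fintype.card P)) * totalEnergy N θ := by
  classical
  have hN' : (0 : ℝ) < N := by exact_mod_cast hN
  set S := cycleBox p 1 N with hS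
  set α := arc a c with hα
  set β := arc b d with hβ
  have hαa : α a = 1 := by simp [hα, arc, hab.trans hbc]
  have hαc : α c = 0 := by simp [hα, arc]
  have hβa : β a = 0 := by simp [hβ, arc, hab]
  have hβc : β c = 1 := by simp [hβ, arc, hbc.le, hcd]
  have hα01 : ∀ l, α l = 0 ∨ α l = 1 := fun l => by simp only [hα, arc]; split_ifs <;> simp
  have hβ01 : ∀ l, β l = 0 ∨ β l = 1 := fun l => by simp only [hβ, arc]; split_ifs <;> simp
  have hfα : flux p α = 0 := flux_arc_eq_zero p (hab.trans hbc).le hac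
  have hfβ : flux p β = 0 := flux_arc_eq_zero p (hbc.trans hcd).le hbd
  -- Edge a lies only on the first loop and edge c only on the second, so J a and J c are the loop
  -- coordinates u and v.
  let r : (Fin (n + 1) → ℤ) → (Fin (n + 1) → ℤ) := fun J => J - J a • α - J c • β
  have hr : ∀ J, J = r J + J a • α + J c • β := fun J => by simp only [r]; abel
  set R := S.image r with hR
  have hRa : ∀ ρ ∈ R, ρ a = 0 ∧ ρ c = 0 ∧ flux p ρ = 0 ∧ ∀ l, 1 - 2 * N ≤ ρ l ∧ ρ l ≤ N := by
    intro ρ hρ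
    obtain ⟨J, hJ, rfl⟩ := Finset.mem_image.1 hρ
    obtain ⟨hJ1, hJ2⟩ := mem_cycleBox.1 hJ
    refine ⟨by simp [r, hαa, hβa], by simp [r, hαc, hβc], ?_, fun l => ?_⟩
    · simp only [r, map_sub, map_smul, hfα, hfβ, hJ2, smul_zero, sub_zero]
    · have h1 := hJ1 l
      have h2 := hJ1 a
      have h3 := hJ1 c
      simp only [r, Pi.sub_apply, Pi.smul_apply, smul_eq_mul]
      rcases hα01 l with h | h <;> rcases hβ01 l with h' | h' <;> rw [h, h'] <;> omega
  -- Adding back arbitrary u, v in [1, N] injects into the circulations with values in [1 - 2N, 3N],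
  -- an interval of 5N integers.
  have hcard : (R.card : ℝ) * (N : ℝ) ^ 2 ≤ (5 * N : ℝ) ^ (n + 2 - Fintype.card P) := by
    have h1 := Finset.card_le_card_of_injOn
      (s := R ×ˢ (Finset.Icc (1 : ℤ) N ×ˢ Finset.Icc (1 : ℤ) N))
      (t := cycleBox p (1 - 2 * N) (3 * N))
      (fun z => z.1 + z.2.1 • α + z.2.2 • β) ?_ ?_
    · have h2 := h1.trans (card_cycleBox_le p hp _ _)
      have h3 : (3 * (N : ℤ) + 1 - (1 - 2 * N)).toNat = 5 * N := by omega
      rw [h3, Finset.card_product, Finset.card_product] at h2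
      simp only [Int.card_Icc, add_sub_cancel_right, Int.toNat_natCast] at h2
      rw [sq]
      exact_mod_cast h2
    · rintro ⟨ρ, u, v⟩ hz
      simp only [Finset.coe_product, Set.mem_prod, Finset.mem_coe, Finset.mem_Icc] at hz
      obtain ⟨-, -, h1, h2⟩ := hRa ρ hz.1
      refine mem_cycleBox.2 ⟨fun l => ?_, ?_⟩
      · have h3 := h2 l
        simp only [Pi.add_apply, Pi.smul_apply, smul_eq_mul]
        rcases hα01 l with h | h <;> rcases hβ01 l with h' | h' <;> rw [h, h'] <;> omega
      · simp only [map_add, map_smul, hfα, hfβ, h1, smul_zero, add_zero]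
    · rintro ⟨ρ, u, v⟩ hz ⟨ρ', u', v'⟩ hz' h
      simp only [Finset.coe_product, Set.mem_prod, Finset.mem_coe] at hz hz'
      obtain ⟨h1, h2, -⟩ := hRa ρ hz.1
      obtain ⟨h1', h2', -⟩ := hRa ρ' hz'.1
      have ha := congrFun h a
      have hc := congrFun h c
      simp only [Pi.add_apply, Pi.smul_apply, smul_eq_mul, hαa, hαc, hβa, hβc, h1, h2, h1', h2']
        at ha hc
      obtain rfl : u = u' := by omega
      obtain rfl : v = v' := by omega
      simpa using h
  have hfiber : ∀ ρ ∈ R, ‖∑ J ∈ S with r J = ρ, ee (θ * (flux p (J ^ 2) (p a) : ℤ))‖ ^ 4 ≤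
      4 * (N : ℝ) ^ 4 * totalEnergy N θ := by
    intro ρ hρ
    obtain ⟨h1, h2, h3, -⟩ := hRa ρ hρ
    let Ω : Finset (ℤ × ℤ) := (Finset.Icc (1 : ℤ) N ×ˢ Finset.Icc (1 : ℤ) N).filter fun z =>
      ∀ l, 1 ≤ ρ l + z.1 * α l + z.2 * β l ∧ ρ l + z.1 * α l + z.2 * β l ≤ N
    have hΩ : ∀ u v, (u, v) ∈ Ω ↔ ∀ l, 1 ≤ ρ l + u * α l + v * β l ∧ ρ l + u * α l + v * β l ≤ N := by
      intro u v
      simp only [Ω, Finset.mem_filter, Finset.mem_product, Finset.mem_Icc, and_iff_right_iff_imp]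
      intro h
      have ha := h a
      have hc := h c
      rw [h1, hαa, hβa] at ha
      rw [h2, hαc, hβc] at hc
      omega
    have hsum : ∑ J ∈ S with r J = ρ, ee (θ * (flux p (J ^ 2) (p a) : ℤ)) =
        ∑ z ∈ Ω, ee (θ * ((flux p (ρ ^ 2) (p a) : ℤ) + z.1 * ((2 * flux p (ρ * α) (p a) : ℤ) : ℝ) +
          z.2 * ((2 * flux p (ρ * β) (p a) : ℤ) : ℝ) - 2 * z.1 * z.2)) := by
      refine Finset.sum_bij (fun J _ => (J a, J c)) ?_ ?_ ?_ ?_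
      · intro J hJ
        obtain ⟨hJ1, rfl⟩ := Finset.mem_filter.1 hJ
        refine (hΩ _ _).2 fun l => ?_
        have := congrFun (hr J) l
        simp only [Pi.add_apply, Pi.smul_apply, smul_eq_mul] at this
        rw [← this]
        exact (mem_cycleBox.1 hJ1).1 l
      · intro J hJ J' hJ' h
        rw [Prod.mk.injEq] at h
        rw [hr J, hr J', (Finset.mem_filter.1 hJ).2, (Finset.mem_filter.1 hJ').2, h.1, h.2]
      · rintro ⟨u, v⟩ hz
        have hz' := (hΩ u v).1 hz
        refine ⟨ρ + u • α + v • β, Finset.mem_filter.2 ⟨mem_cycleBox.2 ⟨fun l => ?_, ?_⟩, ?_⟩, ?_⟩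
        · simpa using hz' l
        · simp only [map_add, map_smul, hfα, hfβ, h3, smul_zero, add_zero]
        · simp only [r, Pi.add_apply, Pi.smul_apply, smul_eq_mul, hαa, hαc, hβa, hβc, h1, h2,
            mul_one, mul_zero, add_zero, zero_add]
          abel
        · simp [hαa, hαc, hβa, hβc, h1, h2]
      · intro J hJ
        obtain ⟨-, rfl⟩ := Finset.mem_filter.1 hJ
        conv_lhs => rw [hr J, flux_sq_add_arcs p hab hbc hcd hac hbd hne]
        push_cast
        rfl
    rw [hsum]
    -- For fixed v, the box constraints are bounds on quantities affine in u with coefficient 0 or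
    -- 1, so each slice is an interval.
    refine norm_sum_bilinear_pow_le N hN θ _ _ _ Ω (Finset.filter_subset _ _) fun v => ⟨?_⟩
    intro u hu u' hu' w hw
    simp only [Set.mem_ofPred_eq, hΩ] at hu hu' ⊢
    intro l
    have h4 := hu l
    have h5 := hu' l
    have h6 := hw.1
    have h7 := hw.2
    rcases hα01 l with h | h <;> rw [h] at h4 h5 ⊢ <;> omega
  set X := 4 * (N : ℝ) ^ 4 * totalEnergy N θ with hX
  have hX0 : 0 ≤ X := by have := totalEnergy_nonneg N θ; positivity
  have hroot : (X ^ (1 / 4 : ℝ)) ^ 4 = X := by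
    rw [← Real.rpow_natCast, ← Real.rpow_mul hX0]; norm_num
  have hx0 : 0 ≤ X ^ (1 / 4 : ℝ) := Real.rpow_nonneg hX0 _
  have htot : ‖∑ J ∈ S, ee (θ * (flux p (J ^ 2) (p a) : ℤ))‖ ≤ R.card * X ^ (1 / 4 : ℝ) := by
    rw [← Finset.sum_fiberwise_of_maps_to (t := R) (g := r) fun J hJ => Finset.mem_image_of_mem r hJ]
    refine (norm_sum_le _ _).trans ?_
    rw [← nsmul_eq_mul]
    refine Finset.sum_le_card_nsmul _ _ _ fun ρ hρ => ?_
    refine le_of_pow_le_pow_left₀ (n := 4) (by norm_num) hx0 ?_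
    rw [hroot]
    exact hfiber ρ hρ
  have h1 : ‖∑ J ∈ S, ee (θ * (flux p (J ^ 2) (p a) : ℤ))‖ ^ 4 ≤ (R.card : ℝ) ^ 4 * X := by
    refine (pow_le_pow_left₀ (norm_nonneg _) htot 4).trans_eq ?_
    rw [mul_pow, hroot]
  calc _ ≤ (N : ℝ) ^ 4 * ((R.card : ℝ) ^ 4 * X) := mul_le_mul_of_nonneg_left h1 (by positivity)
    _ = 4 * (R.card * (N : ℝ) ^ 2) ^ 4 * totalEnergy N θ := by rw [hX]; ring
    _ ≤ 4 * ((5 * N : ℝ) ^ (n + 2 - Fintype.card P)) ^ 4 * totalEnergy N θ := by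
      refine mul_le_mul_of_nonneg_right ?_ (totalEnergy_nonneg N θ)
      refine mul_le_mul_of_nonneg_left ?_ (by norm_num)
      exact pow_le_pow_left₀ (mul_nonneg (Nat.cast_nonneg _) (sq_nonneg _)) hcard 4
    _ = 4 * (5 * N : ℝ) ^ (4 * (n + 2 - Fintype.card P)) * totalEnergy N θ := by
      rw [pow_mul' _ 4 (n + 2 - Fintype.card P)]

theorem pow_four_sum_le {ι : Type*} (s : Finset ι) (f : ι → ℝ) :
    (∑ i ∈ s, f i) ^ 4 ≤ (s.card : ℝ) ^ 3 * ∑ i ∈ s, f i ^ 4 := by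
  have h1 : (∑ i ∈ s, f i) ^ 2 ≤ s.card * ∑ i ∈ s, f i ^ 2 := sq_sum_le_card_mul_sum_sq
  have h2 : (∑ i ∈ s, f i ^ 2) ^ 2 ≤ s.card * ∑ i ∈ s, (f i ^ 2) ^ 2 := sq_sum_le_card_mul_sum_sq
  calc _ = ((∑ i ∈ s, f i) ^ 2) ^ 2 := by ring
    _ ≤ (s.card * ∑ i ∈ s, f i ^ 2) ^ 2 := pow_le_pow_left₀ (by positivity) h1 2
    _ = (s.card : ℝ) ^ 2 * (∑ i ∈ s, f i ^ 2) ^ 2 := by ring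
    _ ≤ (s.card : ℝ) ^ 2 * ((s.card : ℝ) * ∑ i ∈ s, (f i ^ 2) ^ 2) :=
      mul_le_mul_of_nonneg_left h2 (by positivity)
    _ = (s.card : ℝ) ^ 3 * ∑ i ∈ s, (f i ^ 2) ^ 2 := by rw [← mul_assoc, ← pow_succ]
    _ = _ := by simp_rw [← pow_mul]

/-- Opening the square and exchanging sums produces the frequency differences that occur in the
quasi-randomness condition. -/
theorem sum_norm_sq_sum_ee_le {ι : Type*} (S : Finset ι) (q : ι → ℤ) (ω : ℕ → ℝ) (N : ℕ) :
    ∑ J ∈ S, ‖∑ i ∈ Finset.range N, ee (ω i / 2 * q J)‖ ^ 2 ≤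
      ∑ z ∈ Finset.range N ×ˢ Finset.range N, ‖∑ J ∈ S, ee ((ω z.1 - ω z.2) / 2 * q J)‖ := by
  have h : ((∑ J ∈ S, ‖∑ i ∈ Finset.range N, ee (ω i / 2 * q J)‖ ^ 2 : ℝ) : ℂ) =
      ∑ z ∈ Finset.range N ×ˢ Finset.range N, ∑ J ∈ S, ee ((ω z.1 - ω z.2) / 2 * q J) := by
    rw [Complex.ofReal_sum, Finset.sum_comm]
    refine Finset.sum_congr rfl fun J _ => ?_
    rw [Complex.ofReal_pow, ← Complex.mul_conj', map_sum, Finset.sum_mul_sum, Finset.sum_product]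
    refine Finset.sum_congr rfl fun i _ => Finset.sum_congr rfl fun i' _ => ?_
    rw [← ee_sub]
    ring_nf
  have h2 := norm_sum_le (Finset.range N ×ˢ Finset.range N)
    fun z => ∑ J ∈ S, ee ((ω z.1 - ω z.2) / 2 * q J)
  rwa [← h, Complex.norm_real,
    Real.norm_of_nonneg (Finset.sum_nonneg fun _ _ => by positivity)] at h2

/-- Cauchy–Schwarz over circulations, then the fourth power mean over pairs of frequencies, reaches
the energies at the eighth power; hence the exponent δ / 8. -/
theorem IsQuasiRandom.sum_cycleBox_le {δ : ℝ} (hδ : 0 < δ) {ω : ℕ → ℝ}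
    (hω : IsQuasiRandom δ 1 ω) {n : ℕ} {P : Type*} [Fintype P] (p : Fin (n + 1) → P)
    (hp : Function.Surjective p) {a b c d : Fin (n + 1)}
    (hab : a < b) (hbc : b < c) (hcd : c < d) (hac : p a = p c) (hbd : p b = p d)
    (hne : p a ≠ p b) :
    ∃ C : ℝ, 0 < C ∧ ∀ N : ℕ, 1 ≤ N →
      ∑ J ∈ cycleBox p 1 N, ‖∑ i ∈ Finset.range N, ee (ω i / 2 * (flux p (J ^ 2) (p a) : ℤ))‖ ≤
        C * (N : ℝ) ^ (n + 2 - Fintype.card P + 1) * (N : ℝ) ^ (-δ / 8) := by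
  obtain ⟨C, hC, h⟩ := hω.sum_totalEnergy_le hδ
  set D := n + 2 - Fintype.card P with hD
  set K := 4 * (5 : ℝ) ^ (4 * D) * C with hK
  have hK0 : 0 < K := by positivity
  refine ⟨1 + K, by positivity, fun N hN => ?_⟩
  have hN' : (0 : ℝ) < N := by exact_mod_cast hN
  set S := cycleBox p 1 N with hS
  set A := ∑ J ∈ S, ‖∑ i ∈ Finset.range N, ee (ω i / 2 * (flux p (J ^ 2) (p a) : ℤ))‖ with hA
  have hScard : (S.card : ℝ) ≤ (N : ℝ) ^ D := by
    have := card_cycleBox_le p hp 1 N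
    simp only [add_sub_cancel_right, Int.toNat_natCast] at this
    exact_mod_cast this
  set Z := Finset.range N ×ˢ Finset.range N with hZ
  let E : ℕ × ℕ → ℝ := fun z =>
    ‖∑ J ∈ S, ee ((ω z.1 - ω z.2) / 2 * (flux p (J ^ 2) (p a) : ℤ))‖
  have hZcard : (Z.card : ℝ) = (N : ℝ) ^ 2 := by simp [hZ, sq]
  have h1 : A ^ 2 ≤ (N : ℝ) ^ D * ∑ z ∈ Z, E z := by
    refine sq_sum_le_card_mul_sum_sq.trans ?_
    refine mul_le_mul hScard (sum_norm_sq_sum_ee_le S _ ω N)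
      (Finset.sum_nonneg fun _ _ => by positivity) (by positivity)
  have h2 : (N : ℝ) ^ 4 * ∑ z ∈ Z, E z ^ 4 ≤
      4 * (5 * N : ℝ) ^ (4 * D) * (C * (N : ℝ) ^ 6 * (N : ℝ) ^ (-δ)) := by
    rw [Finset.mul_sum]
    refine (Finset.sum_le_sum fun z _ =>
      norm_sum_cycleBox_pow_le p hp hab hbc hcd hac hbd hne N hN _).trans ?_
    rw [← Finset.mul_sum, hZ, Finset.sum_product]
    exact mul_le_mul_of_nonneg_left (h N hN) (by positivity)
  have h3 : (∑ z ∈ Z, E z) ^ 4 ≤ (N : ℝ) ^ 6 * ∑ z ∈ Z, E z ^ 4 := by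
    refine (pow_four_sum_le Z E).trans_eq ?_
    rw [hZcard]
    ring
  have h4 : A ^ 8 ≤ K * ((N : ℝ) ^ (D + 1)) ^ 8 * (N : ℝ) ^ (-δ) := by
    have h5 : (N : ℝ) ^ 4 * A ^ 8 ≤ (N : ℝ) ^ 4 * (K * ((N : ℝ) ^ (D + 1)) ^ 8 * (N : ℝ) ^ (-δ)) := by
      calc (N : ℝ) ^ 4 * A ^ 8 = (N : ℝ) ^ 4 * (A ^ 2) ^ 4 := by ring
        _ ≤ (N : ℝ) ^ 4 * ((N : ℝ) ^ D * ∑ z ∈ Z, E z) ^ 4 := by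
          gcongr
        _ = (N : ℝ) ^ 4 * ((N : ℝ) ^ D) ^ 4 * (∑ z ∈ Z, E z) ^ 4 := by ring
        _ ≤ (N : ℝ) ^ 4 * ((N : ℝ) ^ D) ^ 4 * ((N : ℝ) ^ 6 * ∑ z ∈ Z, E z ^ 4) := by gcongr
        _ = ((N : ℝ) ^ D) ^ 4 * (N : ℝ) ^ 6 * ((N : ℝ) ^ 4 * ∑ z ∈ Z, E z ^ 4) := by ring
        _ ≤ ((N : ℝ) ^ D) ^ 4 * (N : ℝ) ^ 6 *
            (4 * (5 * N : ℝ) ^ (4 * D) * (C * (N : ℝ) ^ 6 * (N : ℝ) ^ (-δ))) := by gcongr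
        _ = _ := by rw [hK, mul_pow]; ring
    exact le_of_mul_le_mul_left h5 (by positivity)
  refine le_of_pow_le_pow_left₀ (n := 8) (by norm_num) (by positivity) (h4.trans ?_)
  have h6 : ((N : ℝ) ^ (-δ / 8)) ^ 8 = (N : ℝ) ^ (-δ) := by
    rw [← Real.rpow_natCast, ← Real.rpow_mul hN'.le]
    congr 1
    push_cast
    ring
  rw [mul_pow, mul_pow, h6]
  -- The constant 1 + K dominates the eighth root of K.
  have h7 : K ≤ (1 + K) ^ 8 := by
    have : 1 + K ≤ (1 + K) ^ 8 := le_self_pow₀ (by linarith) (by norm_num)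
    linarith
  gcongr

end SkewShift

/-! ### Noncrossing partitions and Catalan numbers. -/

namespace SkewShift

/-- Noncrossing partitions of `{0, …, n - 1}`, encoded by the function sending every element to the
least element of its block (and extended by `0`). -/
def noncrossingReps (n : ℕ) : Set (ℕ → ℕ) :=
  {f | (∀ x, n ≤ x → f x = 0) ∧ (∀ x, x < n → f x ≤ x) ∧ (∀ x, x < n → f (f x) = f x) ∧
    ∀ a b c d, a < b → b < c → c < d → d < n → f a = f c → f b = f d → f a = f b}

/-- Glue a partition of `m` elements, whose block of `0` also receives `m`, and a partition of the
`n - m` elements after `m`. -/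
def glue (n m : ℕ) (f g : ℕ → ℕ) (x : ℕ) : ℕ :=
  if x < m then f x else if x = m then 0 else if x ≤ n then m + 1 + g (x - m - 1) else 0

theorem glue_of_lt {n m : ℕ} {f g : ℕ → ℕ} {x : ℕ} (h : x < m) : glue n m f g x = f x := by
  simp [glue, h]

theorem glue_self {n m : ℕ} {f g : ℕ → ℕ} : glue n m f g m = 0 := by
  simp [glue]

theorem glue_of_gt {n m : ℕ} {f g : ℕ → ℕ} {x : ℕ} (h : m < x) (hx : x ≤ n) :
    glue n m f g x = m + 1 + g (x - m - 1) := by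
  simp [glue, h.not_gt, h.ne', hx]

theorem glue_of_lt_right {n m : ℕ} {f g : ℕ → ℕ} {x : ℕ} (hm : m ≤ n) (hx : n < x) :
    glue n m f g x = 0 := by
  rw [glue, if_neg (by omega), if_neg (by omega), if_neg (by omega)]

theorem glue_le {n m : ℕ} {f g : ℕ → ℕ} (hf : f ∈ noncrossingReps m) {x : ℕ}
    (h : x ≤ m) : glue n m f g x ≤ x := by
  rcases h.lt_or_eq with h | rfl
  · rw [glue_of_lt h]
    exact hf.2.1 x h
  · simp [glue_self]

theorem glue_mem {n m : ℕ} (hm : m ≤ n) {f g : ℕ → ℕ} (hf : f ∈ noncrossingReps m)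
    (hg : g ∈ noncrossingReps (n - m)) : glue n m f g ∈ noncrossingReps (n + 1) := by
  obtain ⟨-, hf1, hf2, hf3⟩ := id hf
  obtain ⟨-, hg1, hg2, hg3⟩ := id hg
  have hf0 : 0 < m → f 0 = 0 := fun h => Nat.le_zero.1 (hf1 0 h)
  refine ⟨fun x hx => glue_of_lt_right hm hx, fun x hx => ?_, fun x hx => ?_, ?_⟩
  · rcases le_or_gt x m with h | h
    · exact glue_le hf h
    · rw [glue_of_gt h (by omega)]
      have := hg1 (x - m - 1) (by omega)
      omega
  · rcases lt_trichotomy x m with h | rfl | h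
    · rw [glue_of_lt h, glue_of_lt ((hf1 x h).trans_lt h), hf2 x h]
    · rw [glue_self]
      rcases Nat.eq_zero_or_pos x with rfl | h0
      · exact glue_self
      · rw [glue_of_lt h0, hf0 h0]
    · have := hg1 (x - m - 1) (by omega)
      rw [glue_of_gt h (by omega), glue_of_gt (by omega) (by omega),
        show m + 1 + g (x - m - 1) - m - 1 = g (x - m - 1) by omega, hg2 _ (by omega)]
  · intro a b c d hab hbc hcd hd hac hbd
    have hlow : ∀ x y, x ≤ m → y ≤ n → glue n m f g x = glue n m f g y → y ≤ m := by
      intro x y hx hy hxy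
      by_contra hlt
      have h1 := glue_le (n := n) (g := g) hf hx
      rw [hxy, glue_of_gt (by omega) hy] at h1
      omega
    rcases lt_or_ge m a with ha | ha
    · rw [glue_of_gt (by omega) (by omega), glue_of_gt (by omega) (by omega)] at hac hbd ⊢
      have := hg3 (a - m - 1) (b - m - 1) (c - m - 1) (d - m - 1) (by omega) (by omega) (by omega)
        (by omega) (by omega) (by omega)
      omega
    · have hc : c ≤ m := hlow a c ha (by omega) hac
      have hd' : d ≤ m := hlow b d (by omega) (by omega) hbd
      rw [glue_of_lt (by omega : a < m), glue_of_lt (by omega : c < m)] at hac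
      rw [glue_of_lt (by omega : b < m)] at hbd ⊢
      rw [glue_of_lt (by omega : a < m)]
      rcases hd'.lt_or_eq with h | rfl
      · rw [glue_of_lt h] at hbd
        exact hf3 a b c d hab hbc hcd h hac hbd
      · rw [glue_self] at hbd
        have h0 := hf0 (by omega)
        -- Here d = m was added to the block of 0, so b lies in that block; for a > 0 the crossing 0
        -- < a < b < c is already one of `f`.
        rcases Nat.eq_zero_or_pos a with rfl | ha0
        · rw [hbd, h0]
        · have := hf3 0 a b c ha0 hab hbc hcd (by rw [h0, hbd]) hac
          rw [← this, h0, hbd]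

/-- Cut at the last element m of the block of 0. No block joins an element after m to one before it,
since it would cross the pair 0, m. -/
theorem exists_glue_eq {n : ℕ} {f : ℕ → ℕ} (hf : f ∈ noncrossingReps (n + 1)) :
    ∃ m ≤ n, ∃ f₁ ∈ noncrossingReps m, ∃ f₂ ∈ noncrossingReps (n - m), glue n m f₁ f₂ = f := by
  obtain ⟨hf0, hf1, hf2, hf3⟩ := hf
  have h00 : f 0 = 0 := Nat.le_zero.1 (hf1 0 (by omega))
  set m := Nat.findGreatest (fun x => f x = 0) n with hm
  have hmn : m ≤ n := Nat.findGreatest_le n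
  have hfm : f m = 0 := Nat.findGreatest_spec (P := fun x => f x = 0) (Nat.zero_le n) h00
  have hgt : ∀ x, m < x → x ≤ n → m + 1 ≤ f x := by
    intro x hx hxn
    have h1 : f x ≠ 0 := Nat.findGreatest_is_greatest (P := fun x => f x = 0) hx hxn
    have h2 := hf2 x (by omega)
    by_contra hlt
    rcases Nat.lt_or_ge (f x) m with h | h
    · have := hf3 0 (f x) m x (by omega) h hx (by omega) (by rw [h00, hfm]) h2
      omega
    · have h3 : f x = m := by omega
      rw [h3] at h2
      omega
  refine ⟨m, hmn, fun x => if x < m then f x else 0, ⟨?_, ?_, ?_, ?_⟩,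
    fun x => if x < n - m then f (m + 1 + x) - (m + 1) else 0, ⟨?_, ?_, ?_, ?_⟩, ?_⟩
  · intro x hx
    simp [hx.not_gt]
  · intro x hx
    simpa [hx] using hf1 x (by omega)
  · intro x hx
    have := hf1 x (by omega)
    simp only [hx, if_true]
    rw [if_pos (by omega), hf2 x (by omega)]
  · intro a b c d hab hbc hcd hd
    simp only [show a < m by omega, show b < m by omega, show c < m by omega, hd, if_true]
    exact hf3 a b c d hab hbc hcd (by omega)
  · intro x hx
    simp [hx.not_gt]
  · intro x hx
    have := hf1 (m + 1 + x) (by omega)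
    simp only [hx, if_true]
    omega
  · intro x hx
    have h1 := hf1 (m + 1 + x) (by omega)
    have h2 := hgt (m + 1 + x) (by omega) (by omega)
    simp only [hx, if_true]
    rw [if_pos (by omega), show m + 1 + (f (m + 1 + x) - (m + 1)) = f (m + 1 + x) by omega,
      hf2 _ (by omega)]
  · intro a b c d hab hbc hcd hd
    simp only [show a < n - m by omega, show b < n - m by omega, show c < n - m by omega, hd,
      if_true]
    have ha' := hgt (m + 1 + a) (by omega) (by omega)
    have hb' := hgt (m + 1 + b) (by omega) (by omega)
    have hc' := hgt (m + 1 + c) (by omega) (by omega)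
    have hd' := hgt (m + 1 + d) (by omega) (by omega)
    intro hac hbd
    have := hf3 (m + 1 + a) (m + 1 + b) (m + 1 + c) (m + 1 + d) (by omega) (by omega) (by omega)
      (by omega) (by omega) (by omega)
    omega
  · ext x
    rcases lt_trichotomy x m with h | rfl | h
    · rw [glue_of_lt h, if_pos h]
    · rw [glue_self, hfm]
    · rcases Nat.lt_or_ge n x with hx | hx
      · rw [glue_of_lt_right hmn hx, hf0 x hx]
      · have h1 := hgt x h hx
        rw [glue_of_gt h hx, if_pos (by omega), show m + 1 + (x - m - 1) = x by omega]
        omega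

theorem glue_inj {n m m' : ℕ} (hm : m ≤ n) (hm' : m' ≤ n) {f f' g g' : ℕ → ℕ}
    (hf : f ∈ noncrossingReps m) (hf' : f' ∈ noncrossingReps m')
    (hg : g ∈ noncrossingReps (n - m)) (hg' : g' ∈ noncrossingReps (n - m'))
    (h : glue n m f g = glue n m' f' g') : m = m' ∧ f = f' ∧ g = g' := by
  obtain rfl : m = m' := by
    rcases lt_trichotomy m m' with hlt | heq | hlt
    · have := congrFun h m'
      rw [glue_self, glue_of_gt hlt hm'] at this
      omega
    · exact heq
    · have := congrFun h m
      rw [glue_self, glue_of_gt hlt hm] at this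
      omega
  refine ⟨rfl, ?_, ?_⟩
  · ext x
    rcases Nat.lt_or_ge x m with hx | hx
    · have := congrFun h x
      rwa [glue_of_lt hx, glue_of_lt hx] at this
    · rw [hf.1 x hx, hf'.1 x hx]
  · ext x
    rcases Nat.lt_or_ge x (n - m) with hx | hx
    · have := congrFun h (m + 1 + x)
      rw [glue_of_gt (by omega) (by omega), glue_of_gt (by omega) (by omega),
        show m + 1 + x - m - 1 = x by omega] at this
      omega
    · rw [hg.1 x hx, hg'.1 x hx]

/-- Noncrossing partitions, encoded by their least representatives, correspond to noncrossing
equivalence relations. -/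
theorem bijective_ker_noncrossingReps (n : ℕ) :
    Function.Bijective fun f : noncrossingReps n =>
      (⟨Setoid.ker fun x : Fin n => (f : ℕ → ℕ) x, by
        intro a b c d hab hbc hcd hac hbd
        rw [Quotient.eq, Setoid.ker_def] at hac hbd ⊢
        exact f.2.2.2.2 a b c d hab hbc hcd d.2 hac hbd⟩ :
        {s : Setoid (Fin n) // Noncrossing (Quotient.mk s)}) := by
  constructor
  -- Since x and f x are equivalent, g x = g (f x) ≤ f x; symmetry gives equality.
  · have key : ∀ f g : noncrossingReps n, (∀ x y : Fin n, (f : ℕ → ℕ) x = (f : ℕ → ℕ) y →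
        (g : ℕ → ℕ) x = (g : ℕ → ℕ) y) → ∀ x < n, (g : ℕ → ℕ) x ≤ (f : ℕ → ℕ) x := by
      rintro ⟨f, hf⟩ ⟨g, hg⟩ h x hx
      have h1 := hf.2.1 x hx
      have h2 := h ⟨x, hx⟩ ⟨f x, by omega⟩ (hf.2.2.1 x hx).symm
      simp only at h2 ⊢
      rw [h2]
      exact hg.2.1 _ (by omega)
    intro f g h
    have hker : ∀ x y : Fin n, (f : ℕ → ℕ) x = (f : ℕ → ℕ) y ↔ (g : ℕ → ℕ) x = (g : ℕ → ℕ) y := by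
      intro x y
      have := congrArg (fun s : {s : Setoid (Fin n) // Noncrossing (Quotient.mk s)} => s.1 x y) h
      simpa [Setoid.ker_def] using this
    ext x
    rcases Nat.lt_or_ge x n with hx | hx
    · exact le_antisymm (key g f (fun x y => (hker x y).2) x hx)
        (key f g (fun x y => (hker x y).1) x hx)
    · rw [f.2.1 x hx, g.2.1 x hx]
  · rintro ⟨s, hs⟩
    classical
    have hex : ∀ x, x < n → ∃ y, ∃ (hy : y < n) (hx : x < n), s ⟨y, hy⟩ ⟨x, hx⟩ :=
      fun x hx => ⟨x, hx, hx, s.refl _⟩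
    let f : ℕ → ℕ := fun x => if hx : x < n then Nat.find (hex x hx) else 0
    have hfx : ∀ x (hx : x < n), f x = Nat.find (hex x hx) := fun x hx => by simp [f, hx]
    have hle : ∀ x, x < n → f x ≤ x := by
      intro x hx
      rw [hfx x hx]
      exact Nat.find_min' _ ⟨hx, hx, s.refl _⟩
    have hrel : ∀ x (hx : x < n), s ⟨f x, (hle x hx).trans_lt hx⟩ ⟨x, hx⟩ := by
      intro x hx
      obtain ⟨hy, _, h⟩ := Nat.find_spec (hex x hx)
      convert h using 2
      exact hfx x hx
    have hker : ∀ x y : Fin n, f x = f y ↔ s x y := by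
      intro x y
      constructor
      · intro h
        have h1 := hrel x x.2
        have h2 := hrel y y.2
        have h3 : (⟨f x, (hle x x.2).trans_lt x.2⟩ : Fin n) = ⟨f y, (hle y y.2).trans_lt y.2⟩ :=
          Fin.ext h
        rw [h3] at h1
        exact s.trans (s.symm h1) h2
      · intro h
        refine le_antisymm ?_ ?_
        · rw [hfx x x.2]
          exact Nat.find_min' _ ⟨(hle y y.2).trans_lt y.2, x.2, s.trans (hrel y y.2) (s.symm h)⟩
        · rw [hfx y y.2]
          exact Nat.find_min' _ ⟨(hle x x.2).trans_lt x.2, y.2, s.trans (hrel x x.2) h⟩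
    refine ⟨⟨f, fun x hx => by simp [f, hx.not_gt], hle, fun x hx => ?_, ?_⟩, ?_⟩
    · exact (hker ⟨f x, (hle x hx).trans_lt hx⟩ ⟨x, hx⟩).2 (hrel x hx)
    · intro a b c d hab hbc hcd hd hac hbd
      have := hs ⟨a, by omega⟩ ⟨b, by omega⟩ ⟨c, by omega⟩ ⟨d, hd⟩ hab hbc hcd
        (Quotient.sound ((hker _ _).1 hac)) (Quotient.sound ((hker _ _).1 hbd))
      exact (hker ⟨a, by omega⟩ ⟨b, by omega⟩).2 (Quotient.exact this)
    · ext x y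
      rw [Setoid.ker_def]
      exact hker x y

theorem finite_setoid (α : Type*) [Finite α] : Finite (Setoid α) :=
  Finite.of_injective (fun s : Setoid α => (s : α → α → Prop)) fun _ _ h =>
    Setoid.ext fun x y => iff_of_eq (congrFun (congrFun h x) y)

theorem finite_noncrossingReps (n : ℕ) : Finite (noncrossingReps n) :=
  have := finite_setoid (Fin n)
  Finite.of_injective _ (bijective_ker_noncrossingReps n).1

/-- Gluing is a bijection, and the cut point m indexes Segner's recursion for the Catalan numbers.
-/
theorem card_noncrossingReps_succ (n : ℕ) :
    Nat.card (noncrossingReps (n + 1)) =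
      ∑ m : Fin (n + 1), Nat.card (noncrossingReps m) * Nat.card (noncrossingReps (n - m)) := by
  have hfin := finite_noncrossingReps
  let φ : (Σ m : Fin (n + 1), noncrossingReps m × noncrossingReps (n - m)) →
      noncrossingReps (n + 1) := fun z =>
    ⟨glue n z.1 z.2.1 z.2.2, glue_mem (Nat.lt_succ_iff.1 z.1.2) z.2.1.2 z.2.2.2⟩
  have hφ : Function.Bijective φ := by
    constructor
    · rintro ⟨⟨m, hm⟩, ⟨f, hf⟩, ⟨g, hg⟩⟩ ⟨⟨m', hm'⟩, ⟨f', hf'⟩, ⟨g', hg'⟩⟩ h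
      obtain ⟨rfl, rfl, rfl⟩ := glue_inj (Nat.lt_succ_iff.1 hm) (Nat.lt_succ_iff.1 hm') hf hf'
        hg hg' (congrArg Subtype.val h)
      rfl
    · rintro ⟨f, hf⟩
      obtain ⟨m, hm, f₁, hf₁, f₂, hf₂, rfl⟩ := exists_glue_eq hf
      exact ⟨⟨⟨m, Nat.lt_succ_iff.2 hm⟩, ⟨f₁, hf₁⟩, ⟨f₂, hf₂⟩⟩, rfl⟩
  rw [← Nat.card_eq_of_bijective φ hφ, Nat.card_sigma]
  simp only [Nat.card_prod]

theorem card_noncrossingReps (n : ℕ) : Nat.card (noncrossingReps n) = catalan n := by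
  induction n using Nat.strong_induction_on with
  | _ n ih =>
    cases n with
    | zero =>
      rw [catalan_zero, Nat.card_eq_one_iff_unique]
      refine ⟨⟨?_⟩, ⟨⟨0, by simp [noncrossingReps]⟩⟩⟩
      rintro ⟨f, hf⟩ ⟨g, hg⟩
      ext x
      simp only
      rw [hf.1 x (Nat.zero_le x), hg.1 x (Nat.zero_le x)]
    | succ n =>
      rw [card_noncrossingReps_succ, catalan_succ]
      refine Finset.sum_congr rfl fun m _ => ?_
      rw [ih m (by omega), ih (n - m) (by omega)]

theorem card_noncrossing_setoid (n : ℕ) :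
    Nat.card {s : Setoid (Fin n) // Noncrossing (Quotient.mk s)} = catalan n := by
  rw [← card_noncrossingReps, Nat.card_eq_of_bijective _ (bijective_ker_noncrossingReps n)]

end SkewShift

/-! ### The averaged moment as a sum over circulations. -/

namespace SkewShift

open MeasureTheory

theorem pow_succ_apply_eq_sum_paths {ι R : Type*} [Fintype ι] [DecidableEq ι] [CommRing R]
    (A : Matrix ι ι R) (n : ℕ) (a b : ι) :
    (A ^ (n + 1)) a b = ∑ p : Fin n → ι, ∏ l : Fin (n + 1),
      A (Fin.cons (α := fun _ => ι) a p l) (Fin.snoc (α := fun _ => ι) p b l) := by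
  induction n generalizing a with
  | zero => simp [Fin.snoc]
  | succ n ih =>
    rw [pow_succ', Matrix.mul_apply,
      ← (Fin.consEquiv fun _ : Fin (n + 1) => ι).sum_comp, Fintype.sum_prod_type]
    refine Finset.sum_congr rfl fun c _ => ?_
    rw [ih, Finset.mul_sum]
    refine Finset.sum_congr rfl fun p _ => ?_
    have hc : (Fin.consEquiv fun _ : Fin (n + 1) => ι) (c, p) =
        Fin.cons (α := fun _ => ι) c p := rfl
    rw [hc, ← Fin.cons_snoc_eq_snoc_cons, Fin.prod_univ_succ (n := n + 1)]
    simp only [Fin.cons_zero, Fin.cons_succ]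

theorem trace_pow_succ_eq_sum_closed_walks {ι R : Type*} [Fintype ι] [DecidableEq ι] [CommRing R]
    (A : Matrix ι ι R) (n : ℕ) :
    (A ^ (n + 1)).trace = ∑ q : Fin (n + 1) → ι, ∏ l, A (q l) (q (l + 1)) := by
  rw [Matrix.trace, ← (Fin.consEquiv fun _ : Fin (n + 1) => ι).sum_comp, Fintype.sum_prod_type]
  refine Finset.sum_congr rfl fun a _ => ?_
  rw [Matrix.diag_apply, pow_succ_apply_eq_sum_paths]
  refine Finset.sum_congr rfl fun p _ => Finset.prod_congr rfl fun l _ => ?_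
  simp only [Fin.consEquiv_apply]
  congr 1
  induction l using Fin.lastCases with
  | last => rw [Fin.snoc_last, Fin.last_add_one, Fin.cons_zero]
  | cast i => rw [Fin.snoc_castSucc, Fin.coeSucc_eq_succ, Fin.cons_succ]

theorem pow_mul_comm_rect {m n R : Type*} [Fintype m] [Fintype n] [DecidableEq m] [DecidableEq n]
    [CommRing R] (A : Matrix m n R) (B : Matrix n m R) (k : ℕ) :
    (B * A) ^ k * B = B * (A * B) ^ k := by
  induction k with
  | zero => simp
  | succ k ih => rw [pow_succ', Matrix.mul_assoc, ih, pow_succ', Matrix.mul_assoc, Matrix.mul_assoc]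

theorem trace_mul_pow_comm {m n R : Type*} [Fintype m] [Fintype n] [DecidableEq m] [DecidableEq n]
    [CommRing R] (A : Matrix m n R) (B : Matrix n m R) (k : ℕ) :
    ((B * A) ^ (k + 1)).trace = ((A * B) ^ (k + 1)).trace := by
  rw [pow_succ, ← Matrix.mul_assoc, pow_mul_comm_rect, Matrix.mul_assoc, Matrix.trace_mul_comm,
    pow_succ, Matrix.mul_assoc]

/-- The square of H is block diagonal with blocks X Xᴴ and Xᴴ X, whose powers have the same trace;
this absorbs the factor 1/2. -/
theorem moment_eq (N n : ℕ) (ω x y : Fin N → UnitAddCircle) :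
    moment N N (n + 1) ω x y =
      (1 / (N : ℂ)) * ((X N N ω x y * (X N N ω x y)ᴴ) ^ (n + 1)).trace := by
  have h : H N N ω x y ^ 2 = Matrix.fromBlocks (X N N ω x y * (X N N ω x y)ᴴ) 0 0
      ((X N N ω x y)ᴴ * X N N ω x y) := by
    rw [sq, H, Matrix.fromBlocks_multiply]
    simp
  rw [moment, pow_mul, h, Matrix.fromBlocks_diagonal_pow, Matrix.trace,
    Fintype.sum_sum_type]
  simp only [Matrix.diag_apply, Matrix.fromBlocks_apply₁₁, Matrix.fromBlocks_apply₂₂]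
  have h2 := trace_mul_pow_comm (X N N ω x y) (X N N ω x y)ᴴ n
  simp only [Matrix.trace, Matrix.diag_apply] at h2
  rw [h2]
  simp only [Matrix.trace, Matrix.diag_apply]
  ring

theorem mul_conjTranspose_apply (N : ℕ) (ω y : Fin N → ℝ) (x : Fin N → UnitAddCircle)
    (i i' : Fin N) :
    (X N N (fun i => (ω i : UnitAddCircle)) x (fun i => (y i : UnitAddCircle)) *
      (X N N (fun i => (ω i : UnitAddCircle)) x (fun i => (y i : UnitAddCircle)))ᴴ) i i' =
      (1 / (N : ℂ)) * ∑ j ∈ Finset.Icc (1 : ℤ) N,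
        e (((j ^ 2 - j) / 2 * (ω i - ω i') + j * (y i - y i') : ℝ) + (x i - x i')) := by
  have hs : (((Real.sqrt N)⁻¹ : ℝ) : ℂ) * (((Real.sqrt N)⁻¹ : ℝ) : ℂ) = 1 / (N : ℂ) := by
    rw [← Complex.ofReal_mul, ← mul_inv, Real.mul_self_sqrt (Nat.cast_nonneg _)]
    simp
  rw [Matrix.mul_apply, Finset.mul_sum]
  refine Finset.sum_bij (fun j _ => ((j : ℕ) : ℤ) + 1) ?_ ?_ ?_ ?_
  · intro j _
    simp
  · intro j _ j' _ h
    exact Fin.ext (by omega)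
  · intro j hj
    rw [Finset.mem_Icc] at hj
    exact ⟨⟨(j - 1).toNat, by omega⟩, Finset.mem_univ _, by simp; omega⟩
  · intro j _
    simp only [X, Matrix.conjTranspose_apply, Matrix.of_apply, skewShift_iterate_fst]
    rw [star_mul', Complex.star_def, Complex.conj_ofReal, mul_mul_mul_comm, hs, ← e_neg, ← e_add]
    congr 2
    have hc : (((j : ℕ) + 1).choose 2 : ℝ) =
        ((((j : ℕ) : ℤ) + 1 : ℤ) ^ 2 - (((j : ℕ) : ℤ) + 1 : ℤ) : ℝ) / 2 := by
      rw [Nat.cast_choose_two]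
      push_cast
      ring
    have h1 : ∀ t : ℝ, (((j : ℕ) + 1).choose 2) • (t : UnitAddCircle) =
        (((((((j : ℕ) : ℤ) + 1 : ℤ) ^ 2 - (((j : ℕ) : ℤ) + 1 : ℤ) : ℝ) / 2 * t : ℝ)) :
          UnitAddCircle) := by
      intro t
      rw [← hc, ← AddCircle.coe_nsmul, nsmul_eq_mul]
    have h2 : ∀ t : ℝ, ((j : ℕ) + 1) • (t : UnitAddCircle) =
        ((((((j : ℕ) : ℤ) + 1 : ℤ) : ℝ) * t : ℝ) : UnitAddCircle) := by
      intro t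
      rw [← AddCircle.coe_nsmul, nsmul_eq_mul]
      push_cast
      rfl
    rw [h1, h1, h2, h2, mul_sub, mul_sub]
    simp only [AddCircle.coe_add, AddCircle.coe_sub]
    abel

/-- Cyclic summation by parts, which turns phases attached to edges into phases attached to
vertices. -/
theorem sum_mul_sub_succ {n : ℕ} {P R : Type*} [CommRing R] [Fintype P] (q : Fin (n + 1) → P)
    (g : Fin (n + 1) → R) (w : P → R) :
    ∑ l, g l * (w (q l) - w (q (l + 1))) = ∑ v, w v * flux q g v := by
  rw [sum_flux_mul]
  simp only [mul_sub, Finset.sum_sub_distrib]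
  congr 1
  · exact Finset.sum_congr rfl fun l _ => mul_comm _ _
  · rw [← Equiv.sum_comp (Equiv.addRight (1 : Fin (n + 1))) fun l => w (q l) * g (l - 1)]
    refine Finset.sum_congr rfl fun l _ => ?_
    simp [mul_comm]

theorem sum_sub_succ {n : ℕ} {P R : Type*} [AddCommGroup R] (q : Fin (n + 1) → P)
    (w : P → R) : ∑ l, (w (q l) - w (q (l + 1))) = 0 := by
  rw [Finset.sum_sub_distrib, sub_eq_zero]
  exact (Equiv.sum_comp (Equiv.addRight (1 : Fin (n + 1))) fun l => w (q l)).symm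

theorem prod_walk_eq (N n : ℕ) (ω y : Fin N → ℝ) (x : Fin N → UnitAddCircle)
    (q : Fin (n + 1) → Fin N) :
    ∏ l, (X N N (fun i => (ω i : UnitAddCircle)) x (fun i => (y i : UnitAddCircle)) *
      (X N N (fun i => (ω i : UnitAddCircle)) x (fun i => (y i : UnitAddCircle)))ᴴ)
        (q l) (q (l + 1)) =
      (1 / (N : ℂ)) ^ (n + 1) * ∑ J ∈ Fintype.piFinset fun _ : Fin (n + 1) => Finset.Icc (1 : ℤ) N,
        ee (∑ v, ω v * ((flux q (J ^ 2) v - flux q J v : ℤ) / 2)) *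
          ∏ v, ee (y v * (flux q J v : ℤ)) := by
  simp only [mul_conjTranspose_apply]
  rw [Finset.prod_mul_distrib, Finset.prod_const, Finset.card_univ, Fintype.card_fin,
    Finset.prod_univ_sum]
  congr 1
  refine Finset.sum_congr rfl fun J _ => ?_
  simp only [e_add]
  rw [Finset.prod_mul_distrib, ← e_sum _ fun l => x (q l) - x (q (l + 1)), sum_sub_succ, e_zero,
    mul_one, ← ee_sum, ← ee_add]
  change ∏ l, ee _ = _
  rw [← ee_sum]
  congr 1
  rw [Finset.sum_add_distrib, sum_mul_sub_succ q (fun l => ((J l : ℝ) ^ 2 - J l) / 2) ω,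
    sum_mul_sub_succ q (fun l => (J l : ℝ)) y]
  congr 1
  · refine Finset.sum_congr rfl fun v _ => ?_
    congr 1
    rw [Int.cast_sub, ← eq_intCast (Int.castRingHom ℝ), ← eq_intCast (Int.castRingHom ℝ),
      ← flux_map, ← flux_map, ← Pi.sub_apply, ← map_sub]
    have : (fun l => ((J l : ℝ) ^ 2 - J l) / 2) = (1 / 2 : ℝ) •
        ((fun l => Int.castRingHom ℝ ((J ^ 2) l)) - fun l => Int.castRingHom ℝ (J l)) := by
      ext l
      simp
      ring
    rw [this, map_smul, Pi.smul_apply, smul_eq_mul]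
    ring
  · refine Finset.sum_congr rfl fun v _ => ?_
    congr 1
    exact flux_map (Int.castRingHom ℝ) q J v

theorem continuous_ee : Continuous ee := by
  have : ee = fun t : ℝ => Complex.exp (2 * Real.pi * Complex.I * t) := funext e_coe
  rw [this]
  fun_prop

theorem integral_ee_mul_intCast (m : ℤ) :
    ∫ t in Set.Icc (0 : ℝ) 1, ee (t * m) = if m = 0 then 1 else 0 := by
  split_ifs with h
  · simp [h, ee_zero]
  · rw [integral_Icc_eq_integral_Ioc, ← intervalIntegral.integral_of_le zero_le_one]
    have hne : 2 * Real.pi * Complex.I * m ≠ 0 := by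
      simp [Real.pi_ne_zero, h]
    have h1 : ∀ t : ℝ, ee (t * m) = Complex.exp (2 * Real.pi * Complex.I * m * t) := by
      intro t
      rw [ee, e_coe]
      push_cast
      ring_nf
    simp only [h1]
    rw [integral_exp_mul_complex hne]
    have h2 : Complex.exp (2 * Real.pi * Complex.I * m * (1 : ℝ)) = 1 := by
      rw [Complex.exp_eq_one_iff]
      exact ⟨m, by push_cast; ring⟩
    rw [h2]
    simp

theorem average_prod_ee (N : ℕ) (m : Fin N → ℤ) :
    average (fun y : Fin N → ℝ => ∏ v, ee (y v * m v)) = if m = 0 then 1 else 0 := by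
  rw [average, ← Set.pi_univ_Icc, volume_pi, Measure.restrict_pi_pi,
    integral_fintype_prod_eq_prod (fun v (t : ℝ) => ee (t * m v))]
  simp only [Pi.zero_apply, Pi.one_apply, integral_ee_mul_intCast]
  rw [Finset.prod_ite_zero]
  simp [funext_iff]

/-- Orthogonality of characters in each y_v selects zero flux. The linear part of (J² - J) / 2 then
drops out of the ω-phase. -/
theorem average_moment (N n : ℕ) (ω : Fin N → ℝ) (x : Fin N → UnitAddCircle) :
    average (fun y : Fin N → ℝ => moment N N (n + 1) (fun i => (ω i : UnitAddCircle)) x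
      (fun i => (y i : UnitAddCircle))) =
      (1 / (N : ℂ)) ^ (n + 2) * ∑ q : Fin (n + 1) → Fin N, ∑ J ∈ cycleBox q 1 N,
        ee (∑ v, ω v / 2 * (flux q (J ^ 2) v : ℤ)) := by
  have hint : ∀ m : Fin N → ℤ, IntegrableOn (fun y : Fin N → ℝ => ∏ v, ee (y v * m v))
      (Set.Icc 0 1) := by
    intro m
    refine Continuous.integrableOn_Icc ?_
    exact continuous_finsetProd _ fun v _ => continuous_ee.comp (by fun_prop)
  simp only [moment_eq, trace_pow_succ_eq_sum_closed_walks, prod_walk_eq]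
  rw [average, integral_const_mul, integral_finsetSum _ fun q _ =>
    (integrable_finsetSum _ fun J _ => (hint _).const_mul _).const_mul _]
  rw [pow_succ' (1 / (N : ℂ)) (n + 1), mul_assoc]
  congr 1
  rw [Finset.mul_sum]
  refine Finset.sum_congr rfl fun q _ => ?_
  rw [integral_const_mul, integral_finsetSum _ fun J _ => (hint _).const_mul _, cycleBox,
    Finset.sum_filter]
  congr 1
  refine Finset.sum_congr rfl fun J _ => ?_
  have h := average_prod_ee N (flux q J)
  rw [average] at h
  rw [integral_const_mul, h]
  split_ifs with h0
  · rw [mul_one, h0]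
    congr 1
    refine Finset.sum_congr rfl fun v _ => ?_
    rw [Pi.zero_apply, sub_zero]
    ring
  · rw [mul_zero]

end SkewShift

/-! ### Contribution of each partition. -/

namespace SkewShift

theorem cycleBox_comp {n : ℕ} {P Q : Type*} (p : Fin (n + 1) → P) (f : P → Q)
    (hf : Function.Injective f) (a b : ℤ) : cycleBox (f ∘ p) a b = cycleBox p a b := by
  ext J
  rw [mem_cycleBox, mem_cycleBox]
  refine and_congr_right fun _ => ⟨fun h => ?_, fun h => ?_⟩
  · ext v
    rw [← flux_comp_apply p f hf, h]
    rfl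
  · ext w
    by_cases hw : ∃ v, f v = w
    · obtain ⟨v, rfl⟩ := hw
      rw [flux_comp_apply p f hf, h]
      rfl
    · exact flux_eq_zero_of_notMem_range _ _ _ fun l hl => hw ⟨p l, hl⟩

theorem sum_mul_intCast_flux_comp {n : ℕ} {P Q : Type*} [Fintype P] [Fintype Q]
    (p : Fin (n + 1) → P) (f : P → Q) (w : Q → ℝ) (J : Fin (n + 1) → ℤ) :
    ∑ v, w v * (flux (f ∘ p) J v : ℤ) = ∑ v, w (f v) * (flux p J v : ℤ) := by
  have h1 := sum_flux_mul (f ∘ p) (fun l => Int.castRingHom ℝ (J l)) w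
  have h2 := sum_flux_mul p (fun l => Int.castRingHom ℝ (J l)) (w ∘ f)
  simp only [flux_map] at h1 h2
  exact h1.trans h2.symm

/-- The contribution of the closed walk `ι ∘ p` to the averaged moment. -/
noncomputable def walkSum {n : ℕ} {P : Type*} [Fintype P] (p : Fin (n + 1) → P) (ω : ℕ → ℝ)
    (N : ℕ) (ι : P → Fin N) : ℂ :=
  ∑ J ∈ cycleBox p 1 N, ee (∑ v, ω (ι v) / 2 * (flux p (J ^ 2) v : ℤ))

open Classical in
/-- The sum of the contributions of all labellings of the vertices of `p`. -/
noncomputable def labelledSum {n : ℕ} {P : Type*} [Fintype P] (p : Fin (n + 1) → P) (ω : ℕ → ℝ)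
    (N : ℕ) : ℂ :=
  ∑ ι : P → Fin N, walkSum p ω N ι

open Classical in
/-- The sum of the contributions of the closed walks with the same coincidences as `p`. -/
noncomputable def injectiveSum {n : ℕ} {P : Type*} [Fintype P] (p : Fin (n + 1) → P) (ω : ℕ → ℝ)
    (N : ℕ) : ℂ :=
  ∑ ι : P → Fin N with Function.Injective ι, walkSum p ω N ι

theorem norm_walkSum_le {n : ℕ} {P : Type*} [Fintype P] (p : Fin (n + 1) → P)
    (hp : Function.Surjective p) (ω : ℕ → ℝ) (N : ℕ) (ι : P → Fin N) :
    ‖walkSum p ω N ι‖ ≤ (N : ℝ) ^ (n + 2 - Fintype.card P) := by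
  refine (norm_sum_le _ _).trans ?_
  simp only [norm_ee, Finset.sum_const, nsmul_eq_mul, mul_one]
  have := card_cycleBox_le p hp 1 N
  simp only [add_sub_cancel_right, Int.toNat_natCast] at this
  exact_mod_cast this

/-- Without the injectivity constraint the labels are independent, so for each J the sum over labels
is a product over vertices. -/
theorem labelledSum_eq {n : ℕ} {P : Type*} [Fintype P] (p : Fin (n + 1) → P) (ω : ℕ → ℝ)
    (N : ℕ) : labelledSum p ω N = ∑ J ∈ cycleBox p 1 N,
      ∏ v, ∑ i ∈ Finset.range N, ee (ω i / 2 * (flux p (J ^ 2) v : ℤ)) := by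
  classical
  simp only [labelledSum, walkSum]
  rw [Finset.sum_comm]
  refine Finset.sum_congr rfl fun J _ => ?_
  simp only [Finset.sum_range, ee_sum]
  exact (Fintype.prod_sum fun (v : P) (i : Fin N) =>
    ee (ω i / 2 * (flux p (J ^ 2) v : ℤ))).symm

theorem Noncrossing.labelledSum_eq {n : ℕ} {P : Type} [Fintype P] {p : Fin (n + 1) → P}
    (hp : Noncrossing p) (hsurj : Function.Surjective p) (ω : ℕ → ℝ) (N : ℕ) (hN : 1 ≤ N) :
    labelledSum p ω N = (N : ℂ) ^ (n + 2) := by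
  classical
  have hP : Fintype.card P ≤ n + 1 := by simpa using Fintype.card_le_of_surjective p hsurj
  have h : ∀ J ∈ cycleBox p 1 N,
      ∏ v, ∑ i ∈ Finset.range N, ee (ω i / 2 * (flux p (J ^ 2) v : ℤ)) =
        (N : ℂ) ^ Fintype.card P := by
    intro J hJ
    rw [hp.flux_sq_eq_zero J (mem_cycleBox.1 hJ).2]
    simp [ee_zero]
  rw [SkewShift.labelledSum_eq, Finset.sum_congr rfl h, Finset.sum_const, hp.card_cycleBox hsurj N hN,
    nsmul_eq_mul, Nat.cast_pow, ← pow_add]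
  congr 1
  omega

/-- Only the vertex of a crossing yields cancellation; the other |P| - 1 factors are bounded
trivially by N. -/
theorem IsQuasiRandom.norm_labelledSum_le {δ : ℝ} (hδ : 0 < δ) {ω : ℕ → ℝ}
    (hω : IsQuasiRandom δ 1 ω) {n : ℕ} {P : Type*} [Fintype P] (p : Fin (n + 1) → P)
    (hp : Function.Surjective p) (hcross : ¬ Noncrossing p) :
    ∃ C : ℝ, 0 < C ∧ ∀ N : ℕ, 1 ≤ N →
      ‖labelledSum p ω N‖ ≤ C * (N : ℝ) ^ (n + 2) * (N : ℝ) ^ (-δ / 8) := by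
  classical
  simp only [Noncrossing, not_forall] at hcross
  obtain ⟨a, b, c, d, hab, hbc, hcd, hac, hbd, hne⟩ := hcross
  obtain ⟨C, hC, h⟩ := hω.sum_cycleBox_le hδ p hp hab hbc hcd hac hbd hne
  have hP : Fintype.card P ≤ n + 1 := by simpa using Fintype.card_le_of_surjective p hp
  have hP1 : 1 ≤ Fintype.card P := Fintype.card_pos_iff.2 ⟨p 0⟩
  refine ⟨C, hC, fun N hN => ?_⟩
  have h1 : ∀ J ∈ cycleBox p 1 N,
      ‖∏ v, ∑ i ∈ Finset.range N, ee (ω i / 2 * (flux p (J ^ 2) v : ℤ))‖ ≤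
        ‖∑ i ∈ Finset.range N, ee (ω i / 2 * (flux p (J ^ 2) (p a) : ℤ))‖ *
          (N : ℝ) ^ (Fintype.card P - 1) := by
    intro J _
    rw [norm_prod, ← Finset.mul_prod_erase _ _ (Finset.mem_univ (p a))]
    refine mul_le_mul_of_nonneg_left ?_ (norm_nonneg _)
    refine (Finset.prod_le_prod (fun _ _ => norm_nonneg _) fun v _ =>
      (norm_sum_le _ _).trans_eq ?_).trans_eq (b := ∏ v ∈ Finset.univ.erase (p a), (N : ℝ)) ?_
    · simp
    · simp
  rw [labelledSum_eq]
  refine (norm_sum_le _ _).trans ((Finset.sum_le_sum h1).trans ?_)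
  rw [← Finset.sum_mul]
  refine (mul_le_mul_of_nonneg_right (h N hN) (by positivity)).trans_eq ?_
  have hN2 : (N : ℝ) ^ (n + 2) =
      (N : ℝ) ^ (n + 2 - Fintype.card P + 1) * (N : ℝ) ^ (Fintype.card P - 1) := by
    rw [← pow_add]
    congr 1
    omega
  rw [hN2]
  ring

theorem pow_succ_le_mul_descFactorial (N r : ℕ) :
    N ^ (r + 1) ≤ N * N.descFactorial r + r ^ 2 * N ^ r := by
  induction r with
  | zero => simp
  | succ r ih =>
    have h1 : N * N.descFactorial r ≤ N.descFactorial (r + 1) + r * N ^ r := by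
      rw [Nat.descFactorial_succ]
      calc N * N.descFactorial r ≤ (N - r + r) * N.descFactorial r :=
            Nat.mul_le_mul_right _ (by omega)
        _ = (N - r) * N.descFactorial r + r * N.descFactorial r := by ring
        _ ≤ _ := Nat.add_le_add_left (Nat.mul_le_mul_left _ (Nat.descFactorial_le_pow N r)) _
    calc N ^ (r + 1 + 1) = N * N ^ (r + 1) := by ring
      _ ≤ N * ((N.descFactorial (r + 1) + r * N ^ r) + r ^ 2 * N ^ r) :=
        Nat.mul_le_mul_left _ (ih.trans (Nat.add_le_add_right h1 _))
      _ = N * N.descFactorial (r + 1) + (r ^ 2 + r) * N ^ (r + 1) := by ring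
      _ ≤ _ := Nat.add_le_add_left (Nat.mul_le_mul_right _ (by nlinarith)) _

-- The proportion of non-injective labellings is at most |P|² / N.
open Classical in
theorem card_not_injective_le (P : Type*) [Fintype P] (N : ℕ) :
    N * (Finset.univ.filter fun ι : P → Fin N => ¬ Function.Injective ι).card ≤
      Fintype.card P ^ 2 * N ^ Fintype.card P := by
  have h1 : (Finset.univ.filter fun ι : P → Fin N => Function.Injective ι).card =
      N.descFactorial (Fintype.card P) := by
    rw [← Fintype.card_subtype, Fintype.card_congr (Equiv.subtypeInjectiveEquivEmbedding P (Fin N)),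
      Fintype.card_embedding_eq, Fintype.card_fin]
  have h2 := Finset.card_filter_add_card_filter_not (s := Finset.univ)
    (fun ι : P → Fin N => Function.Injective ι)
  rw [h1, Finset.card_univ, Fintype.card_fun, Fintype.card_fin] at h2
  have h3 := pow_succ_le_mul_descFactorial N (Fintype.card P)
  rw [pow_succ', ← h2, Nat.mul_add] at h3
  rw [h2] at h3
  omega

theorem norm_injectiveSum_sub_le {n : ℕ} {P : Type*} [Fintype P] (p : Fin (n + 1) → P)
    (hp : Function.Surjective p) (ω : ℕ → ℝ) (N : ℕ) (hN : 1 ≤ N) :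
    ‖injectiveSum p ω N - labelledSum p ω N‖ ≤
      (Fintype.card P : ℝ) ^ 2 * (N : ℝ) ^ (n + 1) := by
  have hN' : (0 : ℝ) < N := by exact_mod_cast hN
  have hP : Fintype.card P ≤ n + 1 := by simpa using Fintype.card_le_of_surjective p hp
  classical
  rw [injectiveSum, labelledSum, ← Finset.sum_filter_add_sum_filter_not Finset.univ
    (fun ι : P → Fin N => Function.Injective ι) (walkSum p ω N), sub_add_cancel_left, norm_neg]
  have h1 := norm_sum_le_of_le (Finset.univ.filter fun ι : P → Fin N => ¬ Function.Injective ι)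
    fun ι _ => norm_walkSum_le p hp ω N ι
  refine h1.trans ?_
  rw [Finset.sum_const, nsmul_eq_mul]
  refine le_of_mul_le_mul_left ?_ hN'
  have h2 : (N : ℝ) * (Finset.univ.filter fun ι : P → Fin N => ¬ Function.Injective ι).card ≤
      (Fintype.card P : ℝ) ^ 2 * (N : ℝ) ^ Fintype.card P := by
    exact_mod_cast card_not_injective_le P N
  calc _ = (N : ℝ) * (Finset.univ.filter fun ι : P → Fin N => ¬ Function.Injective ι).card *
        (N : ℝ) ^ (n + 2 - Fintype.card P) := by ring
    _ ≤ (Fintype.card P : ℝ) ^ 2 * (N : ℝ) ^ Fintype.card P *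
        (N : ℝ) ^ (n + 2 - Fintype.card P) := mul_le_mul_of_nonneg_right h2 (by positivity)
    _ = (Fintype.card P : ℝ) ^ 2 * (N : ℝ) ^ (Fintype.card P + (n + 2 - Fintype.card P)) := by
      rw [pow_add]; ring
    _ = _ := by
      rw [show Fintype.card P + (n + 2 - Fintype.card P) = n + 1 + 1 by omega]; ring

-- Closed walks with coincidence partition s are exactly the quotient map of s followed by an
-- injective labelling, and injective relabelling changes neither the circulations nor the phase.
open Classical in
theorem sum_ker_eq_injectiveSum {n : ℕ} (s : Setoid (Fin (n + 1)))
    [Fintype (Quotient s)] (ω : ℕ → ℝ) (N : ℕ) :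
    ∑ q : Fin (n + 1) → Fin N with Setoid.ker q = s, ∑ J ∈ cycleBox q 1 N,
        ee (∑ v : Fin N, ω v / 2 * (flux q (J ^ 2) v : ℤ)) =
      injectiveSum (Quotient.mk s) ω N := by
  symm
  refine Finset.sum_bij (fun ι _ => ι ∘ Quotient.mk s) ?_ ?_ ?_ ?_
  · intro ι hι
    have hι' : Function.Injective ι := (Finset.mem_filter.1 hι).2
    refine Finset.mem_filter.2 ⟨Finset.mem_univ _, ?_⟩
    ext x y
    rw [Setoid.ker_def, Function.comp_apply, Function.comp_apply, hι'.eq_iff, Quotient.eq]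
  · intro ι _ ι' _ h
    exact (Quotient.mk_surjective (s := s)).injective_comp_right h
  · intro q hq
    have hq' : Setoid.ker q = s := (Finset.mem_filter.1 hq).2
    have hrel : ∀ x y, s x y ↔ q x = q y := fun x y => by rw [← hq', Setoid.ker_def]
    refine ⟨Quotient.lift q fun x y h => (hrel x y).1 h, Finset.mem_filter.2
      ⟨@Finset.mem_univ _ (_) _, ?_⟩, rfl⟩
    intro u v huv
    induction u using Quotient.inductionOn with | _ x
    induction v using Quotient.inductionOn with | _ y
    exact Quotient.sound ((hrel x y).2 huv)
  · intro ι hι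
    have hι' : Function.Injective ι := (Finset.mem_filter.1 hι).2
    rw [walkSum, cycleBox_comp _ _ hι']
    refine Finset.sum_congr rfl fun J _ => ?_
    rw [sum_mul_intCast_flux_comp (Quotient.mk s) ι fun v : Fin N => ω v / 2]

open Classical in
theorem IsQuasiRandom.exists_norm_injectiveSum_le {δ : ℝ} (hδ : 0 < δ) {ω : ℕ → ℝ}
    (hω : IsQuasiRandom δ 1 ω) {n : ℕ} (s : Setoid (Fin (n + 1)))
    [Fintype (Quotient s)] :
    ∃ C : ℝ, 0 < C ∧ ∀ N : ℕ, 1 ≤ N →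
      ‖(1 / (N : ℂ)) ^ (n + 2) *
          injectiveSum (Quotient.mk s) ω N -
        (if Noncrossing (Quotient.mk s) then 1 else 0)‖ ≤ C * (N : ℝ) ^ (-δ / 16) := by
  set p : Fin (n + 1) → Quotient s := Quotient.mk s with hp
  have hsurj : Function.Surjective p := Quotient.mk_surjective
  set r := Fintype.card (Quotient s) with hr
  have hmain : ∃ C : ℝ, 0 < C ∧ ∀ N : ℕ, 1 ≤ N →
      ‖labelledSum p ω N - (N : ℂ) ^ (n + 2) * (if Noncrossing p then 1 else 0)‖ ≤
        C * (N : ℝ) ^ (n + 2) * (N : ℝ) ^ (-δ / 16) := by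
    by_cases hnc : Noncrossing p
    · refine ⟨1, one_pos, fun N hN => ?_⟩
      rw [hnc.labelledSum_eq hsurj ω N hN, if_pos hnc, mul_one, sub_self, norm_zero]
      positivity
    · obtain ⟨C, hC, h⟩ := hω.norm_labelledSum_le hδ p hsurj hnc
      refine ⟨C, hC, fun N hN => ?_⟩
      rw [if_neg hnc, mul_zero, sub_zero]
      refine (h N hN).trans (mul_le_mul_of_nonneg_left ?_ (by positivity))
      -- The available exponent δ / 8 is weakened to δ / 16.
      exact Real.rpow_le_rpow_of_exponent_le (by exact_mod_cast hN) (by linarith)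
  obtain ⟨C, hC, h⟩ := hmain
  refine ⟨(r : ℝ) ^ 2 + C, by positivity, fun N hN => ?_⟩
  have hN' : (0 : ℝ) < N := by exact_mod_cast hN
  have hNc : (N : ℂ) ≠ 0 := by exact_mod_cast hN'.ne'
  have h1 := norm_injectiveSum_sub_le p hsurj ω N hN
  have h2 := h N hN
  have h3 : (N : ℝ) ^ (n + 1) ≤ (N : ℝ) ^ (n + 2) * (N : ℝ) ^ (-δ / 16) := by
    -- The loss 1/N from non-injective labellings fits the error term because δ ≤ 2.
    have h4 : (N : ℝ) ^ (-1 : ℝ) ≤ (N : ℝ) ^ (-δ / 16) :=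
      Real.rpow_le_rpow_of_exponent_le (by exact_mod_cast hN) (by linarith [hω.le_two])
    calc (N : ℝ) ^ (n + 1) = (N : ℝ) ^ (n + 2) * (N : ℝ) ^ (-1 : ℝ) := by
          rw [Real.rpow_neg_one, pow_succ _ (n + 1), mul_assoc, mul_inv_cancel₀ hN'.ne', mul_one]
      _ ≤ _ := mul_le_mul_of_nonneg_left h4 (by positivity)
  set A := injectiveSum p ω N with hA
  set B : ℂ := if Noncrossing p then 1 else 0 with hB
  have h5 : (1 / (N : ℂ)) ^ (n + 2) * A - B =
      (1 / (N : ℂ)) ^ (n + 2) * (A - (N : ℂ) ^ (n + 2) * B) := by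
    rw [mul_sub, ← mul_assoc, ← mul_pow, one_div_mul_cancel hNc, one_pow, one_mul]
  have h6 : ‖A - (N : ℂ) ^ (n + 2) * B‖ ≤
      ((r : ℝ) ^ 2 + C) * ((N : ℝ) ^ (n + 2) * (N : ℝ) ^ (-δ / 16)) := by
    have h7 := norm_sub_le_norm_sub_add_norm_sub A (labelledSum p ω N) ((N : ℂ) ^ (n + 2) * B)
    have h8 := mul_le_mul_of_nonneg_left h3 (by positivity : (0 : ℝ) ≤ (r : ℝ) ^ 2)
    linarith
  rw [h5, norm_mul, norm_pow, norm_div, norm_one, Complex.norm_natCast]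
  calc _ ≤ (1 / (N : ℝ)) ^ (n + 2) *
        (((r : ℝ) ^ 2 + C) * ((N : ℝ) ^ (n + 2) * (N : ℝ) ^ (-δ / 16))) :=
        mul_le_mul_of_nonneg_left h6 (by positivity)
    _ = ((1 / (N : ℝ)) * N) ^ (n + 2) * (((r : ℝ) ^ 2 + C) * (N : ℝ) ^ (-δ / 16)) := by
      rw [mul_pow]; ring
    _ = _ := by rw [one_div_mul_cancel hN'.ne', one_pow, one_mul]

end SkewShift

/-! ### Summation over all partitions. -/

theorem theorem1 (δ : ℝ) (hδ : 0 < δ) (ω : ℕ → ℝ) (hω : SkewShift.IsQuasiRandom δ 1 ω)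
    (k : ℕ) (hk : 1 ≤ k) :
    ∃ C : ℝ, 0 < C ∧ ∀ N : ℕ, 1 ≤ N → ∀ x : ℕ → UnitAddCircle,
      ‖SkewShift.average (fun y : Fin N → ℝ =>
          SkewShift.moment N N k (fun i => (ω i : UnitAddCircle)) (fun i => x i)
            (fun i => (y i : UnitAddCircle)))
        - (1 / ((k : ℂ) + 1)) * ((2 * k).choose k : ℂ)‖ ≤ C * (N : ℝ) ^ (-δ / 16) := by
  classical
  obtain ⟨n, rfl⟩ : ∃ n, k = n + 1 := ⟨k - 1, by omega⟩
  have hfin := SkewShift.finite_setoid (Fin (n + 1))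
  have hft : Fintype (Setoid (Fin (n + 1))) := Fintype.ofFinite _
  have hquot : ∀ s : Setoid (Fin (n + 1)), Fintype (Quotient s) := fun s => Fintype.ofFinite _
  choose C hC h using fun s : Setoid (Fin (n + 1)) =>
    hω.exists_norm_injectiveSum_le hδ s
  -- The limit is the number of noncrossing partitions, so moment and limit can be compared
  -- partition by partition.
  have hcat : (1 / (((n + 1 : ℕ) : ℂ) + 1)) * ((2 * (n + 1)).choose (n + 1) : ℂ) =
      ∑ s : Setoid (Fin (n + 1)), if SkewShift.Noncrossing (Quotient.mk s) then (1 : ℂ) else 0 := by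
    have h1 := SkewShift.card_noncrossing_setoid (n + 1)
    rw [Nat.card_eq_fintype_card, Fintype.card_subtype] at h1
    rw [Finset.sum_boole, h1]
    have h2 := succ_mul_catalan_eq_centralBinom (n + 1)
    rw [Nat.centralBinom] at h2
    rw [← h2]
    have h3 : ((n + 1 : ℕ) : ℂ) + 1 ≠ 0 := by exact_mod_cast Nat.succ_ne_zero (n + 1)
    push_cast at h3 ⊢
    field_simp
  refine ⟨∑ s, C s, Finset.sum_pos (fun s _ => hC s) ⟨⊥, Finset.mem_univ _⟩, fun N hN x => ?_⟩
  rw [SkewShift.average_moment N n (fun i => ω i) (fun i => x i), hcat,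
    ← Finset.sum_fiberwise Finset.univ (fun q : Fin (n + 1) → Fin N => Setoid.ker q), Finset.mul_sum,
    ← Finset.sum_sub_distrib, Finset.sum_mul]
  refine norm_sum_le_of_le _ fun s _ => ?_
  rw [SkewShift.sum_ker_eq_injectiveSum s ω N]
  exact h s N hN
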